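/- **Setting.** A two-way transducer $\mathcal T$ has a finite set $Q$ of states, an input alphabet $\Sigma$ containing two distinct endmarkers $\vdash,\dashv$, an output alphabet $\Gamma$, sets of initial and final states, and a finite set of rules $(q,a,v,q',d)\in Q\times\Sigma\times\Gamma^*\times Q\times\{\mathsf{left},\mathsf{right}\}$; no rule moves left on $\vdash$. An input is a word $u=a_1\cdots a_n$ with $a_1=\vdash$, $a_n=\dashv$ and no other occurrence of an endmarker. A configuration $u'\,q\,u''$ has $u'u''=u$; the head reads the first letter of $u''$ and moves one letter to the right or to the left, according to the rule. A run is successful if it goes from $q\,u$ with $q$ initial to $u\,q'$ with $q'$ final. $\mathcal T$ is functional if all successful runs on the same input produce the same output. The *position* of a configuration $u'\,q\,u''$ of a run is $|u'|$ if it is the first configuration or the target of a rightward transition, and $|u'|+1$ if it is the target of a leftward transition. The $(y+1)$-th configuration at position $x$ is identified with the *location* $(x,y)$, which has *level* $y$. Locations are ordered by their occurrence in the run: $\ell\mathrel{\unlhd}\ell'$ (strictly: $\ell\mathrel{\lhd}\ell'$). The crossing sequence $\rho|x$ lists the states at $(x,0),(x,1),\dots$. A run is *normalized* if no two distinct locations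 have the same position, the same state and levels of the same parity. For a set $Z$ of locations, $\mathrm{out}(\rho|Z)$ is the concatenation, in the order of $\rho$, of the outputs of the transitions of $\rho$ whose source and target locations are both in $Z$. Intervals of positions are $[x_1,x_2]$ with $0\le x_1<x_2\le n$. A factor of $\rho$ is *intercepted* by $[x_1,x_2]$ if it is maximal among the factors that visit only positions in $[x_1,x_2]$ and whose transitions read only the letters $a_{x_1+1},\dots,a_{x_2}$ between these positions. The *flow* $F_I$ of $I=[x_1,x_2]$ is the directed graph on $\{0,\dots,\max(h_1,h_2)-1\}$, where $h_i$ is the length of $\rho|x_i$, with an edge $y\mapsto y'$ whenever some factor intercepted by $I$ starts at a location $(x_i,y)$ and ends at a location $(x_j,y')$, $i,j\in\{1,2\}$. The *effect* is $E_I=(F_I,\rho|x_1,\rho|x_2)$. In general a flow for lengths $h_1,h_2$ is a graph on these nodes with in- and out-degrees at most $1$, in which every even $y<h_1$ and every odd $y<h_2$ has an outgoing edge, and every odd $y<h_1$ and every even $y<h_2$ has an incoming edge. Let $F_{LR},F_{RL},F_{LL},F_{RR}$ consist of the edges of $F$ from even to even, odd to odd, even to odd, and odd to even nodes, respectively. With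 $\cdot$ the composition of relations, ${}^*$ the reflexive transitive closure and $\cup$ the union, $F\circ F'$ is the flow with $$(F\circ F')_{LR}=F_{LR}(F'_{LL}F_{RR})^*F'_{LR},\qquad (F\circ F')_{RL}=F'_{RL}(F_{RR}F'_{LL})^*F_{RL},$$ $$(F\circ F')_{LL}=F_{LL}\cup F_{LR}(F'_{LL}F_{RR})^*F'_{LL}F_{RL},\qquad (F\circ F')_{RR}=F'_{RR}\cup F'_{RL}(F_{RR}F'_{LL})^*F_{RR}F'_{LR},$$ if it exists. The product $(F,c_1,c_2)\odot(F',c_1',c_2')$ is $(F\circ F',c_1,c_2')$ if $F\circ F'$ exists and $c_2=c_1'$, and it is a dummy element $\bot$ otherwise. A *loop* is an interval $L=[x_1,x_2]$ of positions with $\rho|x_1=\rho|x_2$; it is *idempotent* if $E_L=E_L\odot E_L$ and $E_L\neq\bot$. A *component* of $L$ is (the node set of) a strongly connected component $C$ of $F_L$. For an idempotent loop $L=[x_1,x_2]$, the *anchor point* of $C$ is the location $(x_1,\max C)$ if $\min C$ is even, and $(x_2,\max C)$ if $\min C$ is odd. The *trace* $\mathrm{tr}(\ell)$ of the anchor point $\ell$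 of $C$ is the concatenation $\beta_0\beta_1\cdots\beta_k$ of the factors intercepted by $L$ that correspond to the successive edges of the cycle $\max C=i_0\mapsto i_1\mapsto\dots\mapsto i_{k+1}=\max C$ of $C$. Let $c_{\max}$ be the maximal number of letters output by a single rule, $h_{\max}=2|Q|-1$, $e_{\max}=(2|Q|)^{2h_{\max}}$ and $$B=c_{\max}\cdot h_{\max}\cdot\bigl(2^{3e_{\max}}+4\bigr)+4c_{\max}.$$ **Theorem.** Let $\rho$ be a normalized successful run of a functional two-way transducer $\mathcal T$ on an input $u$. Let $I=[x_1,x_2]$ be an interval of positions, let $K=[\ell_1,\ell_2]=\{\ell:\ell_1\mathrel{\unlhd}\ell\mathrel{\unlhd}\ell_2\}$ be an interval of locations of $\rho$, where $\ell_1\mathrel{\unlhd}\ell_2$, and let $Z=K\cap(I\times\mathbb N)$. If $|\mathrm{out}(\rho|Z)|>B$, then there exist an idempotent loop $L$ of $\rho$ and an anchor point $\ell$ of (a component of) $L$ such that 1. $x_1<\min(L)<\max(L)<x_2$ (in particular $L\subsetneq I$), 2. $\ell_1\mathrel{\lhd}\ell\mathrel{\lhd}\ell_2$ (in particular $\ell\in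 K$), 3. $\mathrm{out}(\mathrm{tr}(\ell))\neq\varepsilon$. -/

import Mathlib

namespace TwoWay

/-- The two directions in which the head can move. -/
inductive Dir
  | left
  | right

/-- A transition rule `(q, a, w, q', d)`: in state `q = src`, reading the letter `a = letter`,
output the word `w = out`, enter the state `q' = tgt` and move the head in direction `d = dir`. -/
structure Transition (Q A Γ : Type*) where
  src : Q
  letter : A
  out : List Γ
  tgt : Q
  dir : Dir

/-- A two-way transducer with states `Q`, input alphabet `A` (which contains the two distinct
endmarkers `lend` and `rend`), output alphabet `Γ` and a finite set `rules` of transition rules.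
Left transitions on the left endmarker are not allowed. -/
structure Transducer (Q A Γ : Type*) where
  lend : A
  rend : A
  lend_ne_rend : lend ≠ rend
  rules : Finset (Transition Q A Γ)
  initial : Set Q
  final : Set Q
  not_left_lend : ∀ t ∈ rules, t.letter = lend → t.dir = Dir.right

variable {Q A Γ : Type*}

namespace Transducer

/-- Input words have the form `lend v rend`, where the endmarkers do not occur in `v`. -/
def IsInput (T : Transducer Q A Γ) (w : List A) : Prop :=
  ∃ v : List A, w = T.lend :: (v ++ [T.rend]) ∧ T.lend ∉ v ∧ T.rend ∉ v

/-- `cmax`: the maximal number of letters output by a single transition. -/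
def capacity (T : Transducer Q A Γ) : ℕ := T.rules.sup fun t => t.out.length

/-- `hmax = 2|Q| - 1`. -/
def hmax [Fintype Q] (_T : Transducer Q A Γ) : ℕ := 2 * Fintype.card Q - 1

/-- `emax = (2|Q|) ^ (2 hmax)`. -/
def emax [Fintype Q] (T : Transducer Q A Γ) : ℕ := (2 * Fintype.card Q) ^ (2 * T.hmax)

/-- The constant `B = cmax * hmax * (2 ^ (3 emax) + 4) + 4 cmax`. -/
def bound [Fintype Q] (T : Transducer Q A Γ) : ℕ :=
  T.capacity * T.hmax * (2 ^ (3 * T.emax) + 4) + 4 * T.capacity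

end Transducer

/-- A run of `T` on `w`: a sequence of `len` transitions between `len + 1` configurations.
The configuration `u q v` (with `u v = w`) is represented by its state `q` and by the place
`head = |u|` of the head. With `w = a₁ ⋯ aₙ`, the letter read in a configuration is
`a_(head + 1)`, which is `w[head]` with indices counted from `0`. -/
structure Run (T : Transducer Q A Γ) (w : List A) where
  len : ℕ
  state : Fin (len + 1) → Q
  head : Fin (len + 1) → ℕ
  trans : Fin len → Transition Q A Γ
  head_le : ∀ i, head i ≤ w.length
  trans_mem : ∀ k, trans k ∈ T.rules
  trans_src : ∀ k, (trans k).src = state k.castSucc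
  trans_tgt : ∀ k, (trans k).tgt = state k.succ
  trans_letter : ∀ k, w[head k.castSucc]? = some (trans k).letter
  move_right : ∀ k, (trans k).dir = Dir.right → head k.succ = head k.castSucc + 1
  move_left : ∀ k, (trans k).dir = Dir.left → head k.succ + 1 = head k.castSucc

namespace Run

variable {T : Transducer Q A Γ} {w : List A}

/-- A run is successful if it goes from an initial configuration `q w` to a final
configuration `w q'`. -/
def Successful (ρ : Run T w) : Prop :=
  ρ.state 0 ∈ T.initial ∧ ρ.head 0 = 0 ∧
    ρ.state (Fin.last ρ.len) ∈ T.final ∧ ρ.head (Fin.last ρ.len) = w.length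

/-! ### Locations -/

/-- The position of a configuration `u q v`: it is `|u|` if the configuration is the first one
or the target of a rightward transition, and `|u| + 1` if it is the target of a leftward one. -/
def pos (ρ : Run T w) : Fin (ρ.len + 1) → ℕ :=
  Fin.cases (ρ.head 0) fun k =>
    match (ρ.trans k).dir with
    | Dir.right => ρ.head k.succ
    | Dir.left => ρ.head k.succ + 1

/-- The level of a configuration: the number of earlier configurations at the same position. -/
def level (ρ : Run T w) (i : Fin (ρ.len + 1)) : ℕ :=
  (Finset.univ.filter fun j : Fin (ρ.len + 1) => j < i ∧ ρ.pos j = ρ.pos i).card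

/-- The location `(x, y)` of a configuration: it is the `(y + 1)`-th configuration at
position `x`. The locations of `ρ` are the values of this (injective) function. -/
def loc (ρ : Run T w) (i : Fin (ρ.len + 1)) : ℕ × ℕ := (ρ.pos i, ρ.level i)

/-- The run order `ℓ₁ ⊴ ℓ₂` on the locations of `ρ`. -/
def LocLE (ρ : Run T w) (ℓ₁ ℓ₂ : ℕ × ℕ) : Prop :=
  ∃ i j, i ≤ j ∧ ρ.loc i = ℓ₁ ∧ ρ.loc j = ℓ₂

/-- The strict run order `ℓ₁ ⊲ ℓ₂`. -/
def LocLT (ρ : Run T w) (ℓ₁ ℓ₂ : ℕ × ℕ) : Prop := ρ.LocLE ℓ₁ ℓ₂ ∧ ℓ₁ ≠ ℓ₂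

/-- The interval `[ℓ₁, ℓ₂]` of locations. -/
def locInterval (ρ : Run T w) (ℓ₁ ℓ₂ : ℕ × ℕ) : Set (ℕ × ℕ) :=
  {ℓ | ρ.LocLE ℓ₁ ℓ ∧ ρ.LocLE ℓ ℓ₂}

/-- A run is normalized if it never visits two locations with the same position, the same
state, and both at even or both at odd level. -/
def Normalized (ρ : Run T w) : Prop :=
  ∀ i j, ρ.pos i = ρ.pos j → ρ.state i = ρ.state j →
    (Even (ρ.level i) ↔ Even (ρ.level j)) → i = j

/-- The crossing sequence `ρ|x`: the states at the locations `(x, 0), (x, 1), …`. -/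
def crossing (ρ : Run T w) (x : ℕ) : List Q :=
  ((List.finRange (ρ.len + 1)).filter fun i => ρ.pos i = x).map ρ.state

/-! ### Outputs -/

open Classical in
/-- The concatenation, in the order of the run, of the outputs of the transitions in `S`. -/
noncomputable def outOn (ρ : Run T w) (S : Set (Fin ρ.len)) : List Γ :=
  ((List.finRange ρ.len).filter fun k => k ∈ S).flatMap fun k => (ρ.trans k).out

/-- The output of the run. -/
noncomputable def out (ρ : Run T w) : List Γ := ρ.outOn Set.univ

/-- The output of the subsequence `ρ|Z` induced by a set `Z` of locations; its transitions are
those whose source and target locations both belong to `Z`. -/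
noncomputable def outRestrict (ρ : Run T w) (Z : Set (ℕ × ℕ)) : List Γ :=
  ρ.outOn {k | ρ.loc k.castSucc ∈ Z ∧ ρ.loc k.succ ∈ Z}

/-- The output of the factor of the run from the configuration `β.1` to the
configuration `β.2`. -/
noncomputable def outFactor (ρ : Run T w) (β : Fin (ρ.len + 1) × Fin (ρ.len + 1)) : List Γ :=
  ρ.outOn {k | β.1 ≤ k.castSucc ∧ k.succ ≤ β.2}

/-! ### Intercepted factors -/

/-- The factor from configuration `i` to configuration `j` stays within the interval of
positions `[x₁, x₂]`: it visits only positions of this interval, and it never leaves the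
interval at one of its ends, that is, each transition of it reads one of the letters
`a_(x₁+1), …, a_(x₂)` between the positions `x₁` and `x₂`. -/
def StaysIn (ρ : Run T w) (x₁ x₂ : ℕ) (i j : Fin (ρ.len + 1)) : Prop :=
  i ≤ j ∧ (∀ m, i ≤ m → m ≤ j → x₁ ≤ ρ.pos m ∧ ρ.pos m ≤ x₂) ∧
    ∀ k : Fin ρ.len, i ≤ k.castSucc → k.succ ≤ j →
      x₁ ≤ ρ.head k.castSucc ∧ ρ.head k.castSucc < x₂

/-- The factor `β` (given by its first and its last configuration) is intercepted by
`[x₁, x₂]`: it is a maximal factor that stays within this interval. -/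
def Intercepted (ρ : Run T w) (x₁ x₂ : ℕ) (β : Fin (ρ.len + 1) × Fin (ρ.len + 1)) : Prop :=
  ρ.StaysIn x₁ x₂ β.1 β.2 ∧
    ∀ i j, i ≤ β.1 → β.2 ≤ j → ρ.StaysIn x₁ x₂ i j → i = β.1 ∧ j = β.2

end Run

namespace Transducer

/-- A transducer is functional if all successful runs on the same input have the same output. -/
def Functional (T : Transducer Q A Γ) : Prop :=
  ∀ w : List A, T.IsInput w → ∀ ρ ρ' : Run T w,
    ρ.Successful → ρ'.Successful → ρ.out = ρ'.out

end Transducer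

/-! ### Flows and effects

A flow is given by its edge relation. Its nodes are `0, …, max h₁ h₂ - 1`. -/

/-- The edges between even nodes. -/
def partLR (F : ℕ → ℕ → Prop) (y y' : ℕ) : Prop := F y y' ∧ Even y ∧ Even y'

/-- The edges between odd nodes. -/
def partRL (F : ℕ → ℕ → Prop) (y y' : ℕ) : Prop := F y y' ∧ Odd y ∧ Odd y'

/-- The edges from an even node to an odd node. -/
def partLL (F : ℕ → ℕ → Prop) (y y' : ℕ) : Prop := F y y' ∧ Even y ∧ Odd y'

/-- The edges from an odd node to an even node. -/
def partRR (F : ℕ → ℕ → Prop) (y y' : ℕ) : Prop := F y y' ∧ Odd y ∧ Even y'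

open Relation in
/-- The edges of the product `F ∘ F'` of two flows: the union of its `LR`, `RL`, `LL` and
`RR` parts. -/
def flowComp (F F' : ℕ → ℕ → Prop) (y y' : ℕ) : Prop :=
  Comp (Comp (partLR F) (ReflTransGen (Comp (partLL F') (partRR F)))) (partLR F') y y' ∨
  Comp (Comp (partRL F') (ReflTransGen (Comp (partRR F) (partLL F')))) (partRL F) y y' ∨
  (partLL F y y' ∨
    Comp (Comp (Comp (partLR F) (ReflTransGen (Comp (partLL F') (partRR F))))
      (partLL F')) (partRL F) y y') ∨
  (partRR F' y y' ∨
    Comp (Comp (Comp (partRL F') (ReflTransGen (Comp (partRR F) (partLL F'))))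
      (partRR F)) (partLR F') y y')

/-- The conditions on the edges of a flow between crossing sequences of lengths `h₁` and `h₂`:
the nodes are `0, …, max h₁ h₂ - 1`, every node has at most one outgoing and at most one
incoming edge, and it has one where it must have one. -/
structure IsFlow (h₁ h₂ : ℕ) (F : ℕ → ℕ → Prop) : Prop where
  node_src : ∀ y y', F y y' → y < max h₁ h₂
  node_tgt : ∀ y y', F y y' → y' < max h₁ h₂
  out_unique : ∀ y y' y'', F y y' → F y y'' → y' = y''
  in_unique : ∀ y y' y'', F y' y → F y'' y → y' = y''
  left_even : ∀ y < h₁, Even y → ∃ y', F y y'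
  left_odd : ∀ y < h₁, Odd y → ∃ y', F y' y
  right_even : ∀ y < h₂, Even y → ∃ y', F y' y
  right_odd : ∀ y < h₂, Odd y → ∃ y', F y y'

/-- An effect `(F, c₁, c₂)`: a flow and two crossing sequences. -/
@[ext]
structure Effect (Q : Type*) where
  flow : ℕ → ℕ → Prop
  left : List Q
  right : List Q

open Classical in
/-- The product `⊙` of effects, where `none` is the dummy element `⊥`. -/
noncomputable def effectMul : Option (Effect Q) → Option (Effect Q) → Option (Effect Q)
  | some E, some E' =>
      if E.right = E'.left ∧ IsFlow E.left.length E'.right.length (flowComp E.flow E'.flow) then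
        some ⟨flowComp E.flow E'.flow, E.left, E'.right⟩
      else none
  | _, _ => none

namespace Run

variable {T : Transducer Q A Γ} {w : List A}

/-- The edges of the flow of `[x₁, x₂]`: there is an edge from `y` to `y'` if some factor
intercepted by `[x₁, x₂]` starts at a location `(xᵢ, y)` and ends at a location `(xⱼ, y')`,
where `i, j ∈ {1, 2}`. -/
def flow (ρ : Run T w) (x₁ x₂ : ℕ) (y y' : ℕ) : Prop :=
  ∃ β, ρ.Intercepted x₁ x₂ β ∧
    (ρ.loc β.1 = (x₁, y) ∨ ρ.loc β.1 = (x₂, y)) ∧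
    (ρ.loc β.2 = (x₁, y') ∨ ρ.loc β.2 = (x₂, y'))

/-- The effect of `[x₁, x₂]`. -/
def effect (ρ : Run T w) (x₁ x₂ : ℕ) : Option (Effect Q) :=
  some ⟨ρ.flow x₁ x₂, ρ.crossing x₁, ρ.crossing x₂⟩

/-! ### Idempotent loops, components, anchor points and traces -/

/-- An interval `[x₁, x₂]` of positions: `0 ≤ x₁ < x₂ ≤ ω`, where `ω = |w|` is the maximal
position. -/
def IsPosInterval (_ρ : Run T w) (x₁ x₂ : ℕ) : Prop := x₁ < x₂ ∧ x₂ ≤ w.length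

/-- A loop is an interval of positions with equal crossing sequences at its ends. -/
def IsLoop (ρ : Run T w) (x₁ x₂ : ℕ) : Prop :=
  ρ.IsPosInterval x₁ x₂ ∧ ρ.crossing x₁ = ρ.crossing x₂

/-- A loop `L` is idempotent if `E_L = E_L ⊙ E_L` and `E_L ≠ ⊥`. -/
def IsIdempotentLoop (ρ : Run T w) (x₁ x₂ : ℕ) : Prop :=
  ρ.IsLoop x₁ x₂ ∧
    ρ.effect x₁ x₂ = effectMul (ρ.effect x₁ x₂) (ρ.effect x₁ x₂) ∧ ρ.effect x₁ x₂ ≠ none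

/-- The set `C` of nodes is a component of the loop `[x₁, x₂]`, that is, a strongly connected
component of its flow. -/
def IsComponent (ρ : Run T w) (x₁ x₂ : ℕ) (C : Set ℕ) : Prop :=
  ∃ y < max (ρ.crossing x₁).length (ρ.crossing x₂).length,
    C = {y' | Relation.ReflTransGen (ρ.flow x₁ x₂) y y' ∧
      Relation.ReflTransGen (ρ.flow x₁ x₂) y' y}

/-- `ℓ` is the anchor point of the component `C` inside the loop `[x₁, x₂]`: it is
`(x₁, max C)` if `C` is left-to-right (`min C` is even), and `(x₂, max C)` if `C` is
right-to-left (`min C` is odd). -/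
def IsAnchor (_ρ : Run T w) (x₁ x₂ : ℕ) (C : Set ℕ) (ℓ : ℕ × ℕ) : Prop :=
  ∃ m M, IsLeast C m ∧ IsGreatest C M ∧
    ((Even m ∧ ℓ = (x₁, M)) ∨ (Odd m ∧ ℓ = (x₂, M)))

/-- `τ = β₀ β₁ ⋯ βₖ` is the trace of the anchor point of the component `C` inside the loop
`[x₁, x₂]`: the factors `βⱼ` are intercepted by the loop, and they correspond to the successive
edges of the cycle of `C` that starts and ends at `max C`. -/
structure IsTrace (ρ : Run T w) (x₁ x₂ : ℕ) (C : Set ℕ)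
    (τ : List (Fin (ρ.len + 1) × Fin (ρ.len + 1))) : Prop where
  ne_nil : τ ≠ []
  intercepted : ∀ β ∈ τ, ρ.Intercepted x₁ x₂ β
  first : ∀ β ∈ τ.head?, IsGreatest C (ρ.level β.1)
  last : ∀ β ∈ τ.getLast?, IsGreatest C (ρ.level β.2)
  chain : τ.IsChain fun β β' => ρ.level β.2 = ρ.level β'.1
  simple : (τ.map fun β => ρ.level β.1).Nodup

/-- The output of a sequence of factors of the run. -/
noncomputable def outTrace (ρ : Run T w)
    (τ : List (Fin (ρ.len + 1) × Fin (ρ.len + 1))) : List Γ :=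
  τ.flatMap ρ.outFactor

end Run

end TwoWay

/-! A transition outputs at most `capacity` letters, and in a normalized run at most `hmax`
transitions have the head at the same place. A long output over `Z` therefore forces more than `2 ^
(3 * emax)` places strictly between `x₁` and `x₂` at which productive transitions of `Z` are read.

The effects of the intervals between these places form an additive labelling in a finite semigroup.
An effect is determined by the word that records the visits to the two ends, so at most `emax`
effects occur. A Ramsey-type theorem for finite monoids (`hasTriple_of_card`), with the bound `8 ^
N` for `N` labels, yields places `p₀ < p₁ < p₂ < p₃` such that all intervals between them have one
and the same idempotent effect (`exists_uniform`). At each `pᵢ` with `i < 3` a productive transition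
`kᵢ` is read, and it lies in the loop `[pᵢ, pᵢ₊₁]`.

In an idempotent flow the nodes split into blocks `m, …, M` of consecutive levels. Each block is a
cycle with the edges `v ↦ v + 1` and one through edge `M ↦ m` (`isFlowCycle`, `exists_cycle`). Over
the places `pᵢ`, the visits of a lower cycle all precede those of a higher one (`time_lt_succ`), and
one cycle passes the loops in a single direction (`time_through`). Let `Aᵢ` be the time of the
anchor point of the cycle in `[pᵢ, pᵢ₊₁]` one of whose factors contains `kᵢ`. For any two loops,
either `Aᵢ ≤ kⱼ` and `kᵢ < Aⱼ`, or the same with `i` and `j` exchanged (`anchor_between`).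

This orients the three pairs of loops, and in a tournament on three vertices some vertex has both a
predecessor and a successor. Its anchor point lies between two transitions of `K`, hence strictly
inside `K`. Its trace runs through every factor of the cycle, among them the one with the productive
transition, so the trace has nonempty output. -/

namespace TwoWay

/-! ### A Ramsey theorem for additive labellings in finite monoids -/

section Ramsey

variable {M : Type*} [Monoid M]

/-- The preorder of two-sided divisibility. -/
def BelowJ (a b : M) : Prop := ∃ u v, a = u * b * v

lemma BelowJ.refl (a : M) : BelowJ a a := ⟨1, 1, by simp⟩

lemma BelowJ.trans {a b c : M} : BelowJ a b → BelowJ b c → BelowJ a c := by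
  rintro ⟨u, v, rfl⟩ ⟨u', v', rfl⟩
  exact ⟨u * u', v' * v, by simp only [mul_assoc]⟩

lemma belowJ_mul_left (a b : M) : BelowJ (a * b) a := ⟨1, b, by simp⟩

lemma belowJ_mul_right (a b : M) : BelowJ (a * b) b := ⟨a, 1, by simp⟩

/-- In a finite monoid, `a * e = a` and `e ∈ M a M` imply that `e` is a left multiple of `a`. -/
lemma BelowJ.exists_left_mul [Finite M] {a e : M} (h : BelowJ e a) (hae : a * e = a) :
    ∃ z, e = z * a := by
  obtain ⟨u, v, huv⟩ := h
  have hg : e = (u * a) * e * v := by rw [mul_assoc u a e, hae]; exact huv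
  -- Right multiplication by `v` cancels one factor `u * a`. A repetition among the elements `(u *
  -- a) ^ n * e` can thus be shifted down to exponent `0`, which makes `e` a left multiple of `a * e
  -- = a`.
  have back : ∀ n, (u * a) ^ (n + 1) * e * v = (u * a) ^ n * e := by
    intro n
    conv_rhs => rw [hg]
    rw [pow_succ]; simp only [mul_assoc]
  obtain ⟨i, j, hij, heq⟩ := Finite.exists_ne_map_eq_of_infinite fun n : ℕ => (u * a) ^ n * e
  wlog hlt : i < j generalizing i j
  · exact this j i hij.symm heq.symm (by omega)
  obtain ⟨d, rfl⟩ := Nat.exists_eq_add_of_lt hlt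
  have cancel : ∀ i, (u * a) ^ i * e = (u * a) ^ (i + d + 1) * e → e = (u * a) ^ (d + 1) * e := by
    intro i
    induction i with
    | zero => intro h; simpa using h
    | succ i ih =>
      intro h
      apply ih
      rw [← back i, h, ← back (i + d + 1)]
      congr 3; ring
  refine ⟨(u * a) ^ d * u, ?_⟩
  conv_lhs => rw [cancel i heq, pow_succ]
  simp only [mul_assoc, hae]

/-- Since `e = z * a`, whatever stabilizes `a` on the right also stabilizes `e`. -/
lemma BelowJ.mul_eq_left [Finite M] {a e e' : M} (h : BelowJ e a) (hae : a * e = a)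
    (hae' : a * e' = a) : e * e' = e := by
  obtain ⟨z, hz⟩ := h.exists_left_mul hae
  rw [hz, mul_assoc, hae']

/-- A labelling of the pairs of `X` is additive. -/
def Additive (E : ℕ → ℕ → M) (X : Finset ℕ) : Prop :=
  ∀ i ∈ X, ∀ j ∈ X, ∀ k ∈ X, i < j → j < k → E i j * E j k = E i k

/-- Three consecutive intervals with the same idempotent label. -/
def HasTriple (E : ℕ → ℕ → M) (X : Finset ℕ) : Prop :=
  ∃ i ∈ X, ∃ j ∈ X, ∃ k ∈ X, ∃ l ∈ X, i < j ∧ j < k ∧ k < l ∧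
    E j k = E i j ∧ E k l = E i j ∧ E i j * E i j = E i j

lemma exists_three {s : Finset ℕ} (h : 2 < s.card) :
    ∃ x ∈ s, ∃ y ∈ s, ∃ z ∈ s, x < y ∧ y < z := by
  let f := s.orderEmbOfFin rfl
  refine ⟨f ⟨0, by omega⟩, s.orderEmbOfFin_mem rfl _, f ⟨1, by omega⟩, s.orderEmbOfFin_mem rfl _,
    f ⟨2, by omega⟩, s.orderEmbOfFin_mem rfl _, ?_, ?_⟩ <;>
  · apply f.strictMono; simp

/-- A long chain with labels in a single class of mutual divisibility has a triple. -/
lemma hasTriple_of_equiv [Finite M] {E : ℕ → ℕ → M} {C : Finset ℕ} (hE : Additive E C)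
    {J : Finset M} (hJ : ∀ a ∈ J, ∀ b ∈ J, BelowJ a b)
    (hCJ : ∀ i ∈ C, ∀ j ∈ C, i < j → E i j ∈ J)
    (hcard : 1 + J.card * (1 + J.card * 2) < C.card) : HasTriple E C := by
  classical
  have hne : C.Nonempty := Finset.card_pos.1 (by omega)
  set x₀ := C.min' hne with hx₀
  have hx₀C : x₀ ∈ C := C.min'_mem hne
  have hlt : ∀ x ∈ C.erase x₀, x₀ < x := fun x hx =>
    lt_of_le_of_ne (C.min'_le x (Finset.mem_of_mem_erase hx)) (Finset.ne_of_mem_erase hx).symm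
  obtain ⟨a, haJ, hfib⟩ := Finset.exists_lt_card_fiber_of_mul_lt_card_of_maps_to
    (s := C.erase x₀) (t := J) (f := fun x => E x₀ x) (n := 1 + J.card * 2)
    (fun x hx => hCJ _ hx₀C _ (Finset.mem_of_mem_erase hx) (hlt x hx))
    (by rw [Finset.card_erase_of_mem hx₀C]; omega)
  set D := (C.erase x₀).filter fun x => E x₀ x = a with hD
  have hDC : ∀ x ∈ D, x ∈ C ∧ x₀ < x ∧ E x₀ x = a := fun x hx => by
    rw [hD, Finset.mem_filter] at hx
    exact ⟨Finset.mem_of_mem_erase hx.1, hlt x hx.1, hx.2⟩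
  have hDne : D.Nonempty := Finset.card_pos.1 (by omega)
  set z := D.max' hDne with hz
  have hzD : z ∈ D := D.max'_mem hDne
  have hltz : ∀ x ∈ D.erase z, x < z := fun x hx =>
    lt_of_le_of_ne (D.le_max' x (Finset.mem_of_mem_erase hx)) (Finset.ne_of_mem_erase hx)
  -- All points of `D` have the same label `a` from `x₀`, so labels inside `D` stabilize `a`. By
  -- mutual divisibility they are left zeros for one another, in particular idempotent.
  have hstab : ∀ x ∈ D, ∀ y ∈ D, x < y → a * E x y = a := by
    intro x hx y hy hxy
    obtain ⟨hxC, hx0, hxa⟩ := hDC x hx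
    obtain ⟨hyC, hy0, hya⟩ := hDC y hy
    have := hE _ hx₀C _ hxC _ hyC hx0 hxy
    rwa [hxa, hya] at this
  have hmul : ∀ x ∈ D, ∀ y ∈ D, ∀ x' ∈ D, ∀ y' ∈ D, x < y → x' < y' → E x y * E x' y' = E x y :=
    fun x hx y hy x' hx' y' hy' hxy hxy' =>
      (hJ _ (hCJ _ (hDC x hx).1 _ (hDC y hy).1 hxy) _ haJ).mul_eq_left
        (hstab x hx y hy hxy) (hstab x' hx' y' hy' hxy')
  obtain ⟨f, -, hfib'⟩ := Finset.exists_lt_card_fiber_of_mul_lt_card_of_maps_to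
    (s := D.erase z) (t := J) (f := fun x => E x z) (n := 2)
    (fun x hx => hCJ _ (hDC x (Finset.mem_of_mem_erase hx)).1 _ (hDC z hzD).1 (hltz x hx))
    (by rw [Finset.card_erase_of_mem hzD]; omega)
  obtain ⟨x, hx, y, hy, w, hw, hxy, hyw⟩ := exists_three hfib'
  simp only [Finset.mem_filter] at hx hy hw
  -- By the left-zero law, a label inside `D` depends only on its left point. The second pigeonhole
  -- makes this label the same for three left points, with `z` as the fourth point.
  have key : ∀ x ∈ D, ∀ y ∈ D.erase z, x < y → E x y = E x z := by
    intro x hx y hy hxy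
    have hy' := Finset.mem_of_mem_erase hy
    rw [← hE _ (hDC x hx).1 _ (hDC y hy').1 _ (hDC z hzD).1 hxy (hltz y hy),
      hmul x hx y hy' y hy' z hzD hxy (hltz y hy)]
  have hxD := Finset.mem_of_mem_erase hx.1
  have hyD := Finset.mem_of_mem_erase hy.1
  have hwD := Finset.mem_of_mem_erase hw.1
  refine ⟨x, (hDC x hxD).1, y, (hDC y hyD).1, w, (hDC w hwD).1, z, (hDC z hzD).1, hxy, hyw,
    hltz w hw.1, ?_, ?_, hmul x hxD y hyD x hxD y hyD hxy hxy⟩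
  · rw [key x hxD y hy.1 hxy, key y hyD w hw.1 hyw, hx.2, hy.2]
  · rw [key x hxD y hy.1 hxy, hx.2, hw.2]

/-- Greedy decomposition of `X` into blocks without labels in `J`. -/
lemma exists_chain {E : ℕ → ℕ → M} {U J : Set M} {g : ℕ}
    (hJ : ∀ a b : M, a ∈ J ∨ b ∈ J → a * b ∈ U ∪ J → a * b ∈ J) (X : Finset ℕ)
    (hE : Additive E X) (hX : ∀ i ∈ X, ∀ j ∈ X, i < j → E i j ∈ U ∪ J)
    (hg : ∀ Y ⊆ X, (∀ i ∈ Y, ∀ j ∈ Y, i < j → E i j ∈ U \ J) → Y.card ≤ g) :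
    ∃ C ⊆ X, (∀ i ∈ C, ∀ j ∈ C, i < j → E i j ∈ J) ∧ X.card ≤ C.card * g := by
  classical
  induction X using Finset.strongInduction with
  | H X ih =>
    rcases X.eq_empty_or_nonempty with rfl | hne
    · exact ⟨∅, by simp, by simp, by simp⟩
    set x₀ := X.min' hne
    have hx₀ : x₀ ∈ X := X.min'_mem hne
    have hmin : ∀ x ∈ X, x₀ ≤ x := fun x hx => X.min'_le x hx
    -- The first block: a label of `J` between two of its points would propagate to a label of `J`
    -- starting at `x₀`. Every point outside the block has a label in `J` from `x₀`, so `x₀` extends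
    -- the chain of the remaining points.
    set B := X.filter fun x => x = x₀ ∨ E x₀ x ∉ J with hB
    have hBX : B ⊆ X := Finset.filter_subset _ _
    have hx₀B : x₀ ∈ B := by simp [hB, hx₀]
    have hBU : ∀ i ∈ B, ∀ j ∈ B, i < j → E i j ∈ U \ J := by
      intro i hi j hj hij
      have hj0 : x₀ < j := lt_of_le_of_lt (hmin i (hBX hi)) hij
      have hjJ : E x₀ j ∉ J := by
        rw [hB, Finset.mem_filter] at hj
        exact hj.2.resolve_left hj0.ne'
      have hnJ : E i j ∉ J := by
        intro hJij
        rcases (hmin i (hBX hi)).eq_or_lt with h | h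
        · rw [← h] at hJij; exact hjJ hJij
        · have hadd := hE _ hx₀ _ (hBX hi) _ (hBX hj) h hij
          apply hjJ
          rw [← hadd]
          exact hJ _ _ (Or.inr hJij) (hadd ▸ hX _ hx₀ _ (hBX hj) hj0)
      exact ⟨(hX _ (hBX hi) _ (hBX hj) hij).resolve_right hnJ, hnJ⟩
    have hsub : X \ B ⊆ X := Finset.sdiff_subset
    obtain ⟨C, hCX, hC, hcard⟩ := ih (X \ B)
      (Finset.sdiff_ssubset hBX ⟨x₀, hx₀B⟩)
      (fun i hi j hj k hk => hE i (hsub hi) j (hsub hj) k (hsub hk))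
      (fun i hi j hj => hX i (hsub hi) j (hsub hj))
      (fun Y hY => hg Y (hY.trans hsub))
    have hx₀C : x₀ ∉ C := fun h => (Finset.mem_sdiff.1 (hCX h)).2 hx₀B
    refine ⟨insert x₀ C, ?_, ?_, ?_⟩
    · exact Finset.insert_subset hx₀ (hCX.trans hsub)
    · intro i hi j hj hij
      rw [Finset.mem_insert] at hi hj
      rcases hj with rfl | hj
      · rcases hi with rfl | hi
        · exact absurd hij (lt_irrefl _)
        · exact absurd hij (not_lt.2 (hmin i (hsub (hCX hi))))
      · rcases hi with rfl | hi
        · have := Finset.mem_sdiff.1 (hCX hj)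
          by_contra hn
          exact this.2 (by simp [hB, this.1, hn])
        · exact hC i hi j hj hij
    · rw [Finset.card_insert_of_notMem hx₀C, add_mul, one_mul]
      have h1 := hg B hBX hBU
      have h2 := Finset.card_sdiff_add_card_eq_card hBX
      omega

/-- This estimate is the source of the base `8`, and hence of the factor `3` in `2 ^ (3 * emax)`. -/
lemma one_add_le_pow (k : ℕ) (hk : 1 ≤ k) : 1 + k * (1 + k * 2) ≤ 8 ^ k := by
  induction k, hk using Nat.le_induction with
  | base => norm_num
  | succ k hk ih =>
    rw [pow_succ]
    nlinarith [ih]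

/-- An additive labelling with `N` values of more than `8 ^ N` points in a finite monoid has
three consecutive intervals with the same idempotent label. -/
theorem hasTriple_of_card [Finite M] {E : ℕ → ℕ → M} (V : Finset M) (X : Finset ℕ)
    (hE : Additive E X) (hV : ∀ i ∈ X, ∀ j ∈ X, i < j → E i j ∈ V)
    (hcard : 8 ^ V.card < X.card) : HasTriple E X := by
  classical
  induction V using Finset.strongInduction generalizing X with
  | H V ih =>
    by_contra hno
    have hmono : ∀ Y ⊆ X, ¬ HasTriple E Y := by
      rintro Y hY ⟨i, hi, j, hj, k, hk, l, hl, h⟩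
      exact hno ⟨i, hY hi, j, hY hj, k, hY hk, l, hY hl, h⟩
    have hadd : ∀ Y ⊆ X, Additive E Y := fun Y hY i hi j hj k hk =>
      hE i (hY hi) j (hY hj) k (hY hk)
    rcases V.eq_empty_or_nonempty with rfl | hne
    · obtain ⟨x, hx, y, hy, hxy⟩ := Finset.one_lt_card.1 (by simpa using hcard)
      rcases lt_or_gt_of_ne hxy with h | h
      · simpa using hV x hx y hy h
      · simpa using hV y hy x hx h
    -- A minimal divisibility class `J` of `V` behaves as an ideal: a product that stays in `V` and
    -- has a factor in `J` lies in `J`. Blocks without labels in `J` are handled by induction, and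
    -- the chain of their first points by `hasTriple_of_equiv`.
    obtain ⟨v, hvV, hvmin⟩ : ∃ v ∈ V, ∀ u ∈ V, BelowJ u v → BelowJ v u := by
      let _ : Preorder M :=
        { le := BelowJ, le_refl := BelowJ.refl, le_trans := fun _ _ _ => BelowJ.trans }
      obtain ⟨v, hv⟩ := V.exists_minimal hne
      exact ⟨v, hv.1, fun u hu huv => hv.2 hu huv⟩
    set J := V.filter fun u => BelowJ u v with hJ
    have hJV : J ⊆ V := Finset.filter_subset _ _
    have hvJ : v ∈ J := by simp [hJ, hvV, BelowJ.refl]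
    have hJJ : ∀ a ∈ J, ∀ b ∈ J, BelowJ a b := by
      intro a ha b hb
      rw [hJ, Finset.mem_filter] at ha hb
      exact ha.2.trans (hvmin b hb.1 hb.2)
    obtain ⟨C, hCX, hC, hXC⟩ := exists_chain (E := E) (U := (V : Set M)) (J := (J : Set M))
      (g := 8 ^ (V \ J).card)
      (by
        intro a b hab hm
        have hm' : a * b ∈ V := by
          rcases hm with h | h
          · exact h
          · exact hJV h
        simp only [Finset.mem_coe] at hab ⊢
        rw [hJ, Finset.mem_filter]
        refine ⟨hm', ?_⟩
        rcases hab with h | h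
        · exact (belowJ_mul_left a b).trans (Finset.mem_filter.1 h).2
        · exact (belowJ_mul_right a b).trans (Finset.mem_filter.1 h).2)
      X hE (fun i hi j hj hij => Or.inl (hV i hi j hj hij))
      (by
        intro Y hY hYU
        by_contra hlt
        exact hmono Y hY (ih (V \ J) (Finset.sdiff_ssubset hJV ⟨v, hvJ⟩) Y (hadd Y hY)
          (fun i hi j hj hij => by simpa using hYU i hi j hj hij) (by omega)))
    have hCle : C.card ≤ 1 + J.card * (1 + J.card * 2) := by
      by_contra hlt
      exact hmono C hCX (hasTriple_of_equiv (hadd C hCX) hJJ hC (by omega))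
    have hJpos : 1 ≤ J.card := Finset.card_pos.2 ⟨v, hvJ⟩
    have h1 : C.card ≤ 8 ^ J.card := hCle.trans (one_add_le_pow _ hJpos)
    have h2 : (V \ J).card + J.card = V.card := Finset.card_sdiff_add_card_eq_card hJV
    have h3 : C.card * 8 ^ (V \ J).card ≤ 8 ^ V.card := by
      rw [← h2, pow_add, mul_comm]
      exact Nat.mul_le_mul_left _ h1
    omega

end Ramsey

end TwoWay

namespace TwoWay

/-! ### Composition of flows as alternating walks, and its associativity -/

section FlowComp

variable {F F' : ℕ → ℕ → Prop}

/-- Alternating walks through two adjacent intervals with the flows `F` and `F'`; the Boolean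
tells which of the two intervals is traversed next. -/
inductive FlowWalk (F F' : ℕ → ℕ → Prop) : Bool → ℕ → ℕ → Prop
  | exitLeft {y z : ℕ} : F y z → Odd z → FlowWalk F F' false y z
  | crossRight {y z y' : ℕ} : F y z → Even z → FlowWalk F F' true z y' → FlowWalk F F' false y y'
  | exitRight {y z : ℕ} : F' y z → Even z → FlowWalk F F' true y z
  | crossLeft {y z y' : ℕ} : F' y z → Odd z → FlowWalk F F' false z y' → FlowWalk F F' true y y'

open Relation

/-- The identity `A (BA)* = (AB)* A`, in the direction needed to regroup walks. -/
lemma exists_comp_star {α : Type*} {A B : α → α → Prop} {x y z : α}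
    (hxy : A x y) (h : ReflTransGen (Comp B A) y z) :
    ∃ t, ReflTransGen (Comp A B) x t ∧ A t z := by
  induction h with
  | refl => exact ⟨x, .refl, hxy⟩
  | tail _ hbc ih =>
    obtain ⟨t, ht, htb⟩ := ih
    obtain ⟨s, hs, hsc⟩ := hbc
    exact ⟨s, ht.tail ⟨_, htb, hs⟩, hsc⟩

/-- After a crossing to the right the node is even, after one to the left it is odd. Bouncing at the
common border is thus the starred part of the product, and the alternatives are the two ways of
finally leaving. -/
lemma FlowWalk.decompose {s : Bool} {y y' : ℕ} (h : FlowWalk F F' s y y') :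
    (s = true → Even y → ∃ z, ReflTransGen (Comp (partLL F') (partRR F)) y z ∧
      (partLR F' z y' ∨ Comp (partLL F') (partRL F) z y')) ∧
    (s = false → Odd y → ∃ z, ReflTransGen (Comp (partRR F) (partLL F')) y z ∧
      (partRL F z y' ∨ Comp (partRR F) (partLR F') z y')) := by
  induction h with
  | exitLeft hF hz => exact ⟨by simp, fun _ hy => ⟨_, .refl, Or.inl ⟨hF, hy, hz⟩⟩⟩
  | exitRight hF hz => exact ⟨fun _ hy => ⟨_, .refl, Or.inl ⟨hF, hy, hz⟩⟩, by simp⟩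
  | crossRight hF hz _ ih =>
    refine ⟨by simp, fun _ hy => ?_⟩
    obtain ⟨t, ht, h⟩ := ih.1 rfl hz
    obtain ⟨r, hr, hrt⟩ := exists_comp_star (A := partRR F) ⟨hF, hy, hz⟩ ht
    rcases h with h | ⟨q, hq, hqy⟩
    · exact ⟨r, hr, Or.inr ⟨t, hrt, h⟩⟩
    · exact ⟨q, hr.tail ⟨t, hrt, hq⟩, Or.inl hqy⟩
  | crossLeft hF hz _ ih =>
    refine ⟨fun _ hy => ?_, by simp⟩
    obtain ⟨t, ht, h⟩ := ih.2 rfl hz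
    obtain ⟨r, hr, hrt⟩ := exists_comp_star (A := partLL F') ⟨hF, hy, hz⟩ ht
    rcases h with h | ⟨q, hq, hqy⟩
    · exact ⟨r, hr, Or.inr ⟨t, hrt, h⟩⟩
    · exact ⟨q, hr.tail ⟨t, hrt, hq⟩, Or.inl hqy⟩

lemma FlowWalk.of_star_true {y z y' : ℕ}
    (h : ReflTransGen (Comp (partLL F') (partRR F)) y z) (hz : FlowWalk F F' true z y') :
    FlowWalk F F' true y y' := by
  induction h using ReflTransGen.head_induction_on with
  | refl => exact hz
  | head h _ ih =>
    obtain ⟨t, h1, h2⟩ := h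
    exact .crossLeft h1.1 h1.2.2 (.crossRight h2.1 h2.2.2 ih)

lemma FlowWalk.of_star_false {y z y' : ℕ}
    (h : ReflTransGen (Comp (partRR F) (partLL F')) y z) (hz : FlowWalk F F' false z y') :
    FlowWalk F F' false y y' := by
  induction h using ReflTransGen.head_induction_on with
  | refl => exact hz
  | head h _ ih =>
    obtain ⟨t, h1, h2⟩ := h
    exact .crossRight h1.1 h1.2.2 (.crossLeft h2.1 h2.2.2 ih)

/-- Unifies the four parts of the product: a walk enters on the left at an even node and on the
right at an odd node. -/
lemma flowComp_iff {y y' : ℕ} : flowComp F F' y y' ↔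
    (Even y ∧ FlowWalk F F' false y y') ∨ (Odd y ∧ FlowWalk F F' true y y') := by
  constructor
  · rintro (⟨t, ⟨r, h1, h2⟩, h3⟩ | ⟨t, ⟨r, h1, h2⟩, h3⟩ | (h | ⟨q, ⟨t, ⟨r, h1, h2⟩, h3⟩, h4⟩) |
      (h | ⟨q, ⟨t, ⟨r, h1, h2⟩, h3⟩, h4⟩))
    · exact Or.inl ⟨h1.2.1, .crossRight h1.1 h1.2.2 (.of_star_true h2 (.exitRight h3.1 h3.2.2))⟩
    · exact Or.inr ⟨h1.2.1, .crossLeft h1.1 h1.2.2 (.of_star_false h2 (.exitLeft h3.1 h3.2.2))⟩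
    · exact Or.inl ⟨h.2.1, .exitLeft h.1 h.2.2⟩
    · exact Or.inl ⟨h1.2.1, .crossRight h1.1 h1.2.2
        (.of_star_true h2 (.crossLeft h3.1 h3.2.2 (.exitLeft h4.1 h4.2.2)))⟩
    · exact Or.inr ⟨h.2.1, .exitRight h.1 h.2.2⟩
    · exact Or.inr ⟨h1.2.1, .crossLeft h1.1 h1.2.2
        (.of_star_false h2 (.crossRight h3.1 h3.2.2 (.exitRight h4.1 h4.2.2)))⟩
  · rintro (⟨hy, h⟩ | ⟨hy, h⟩)
    · cases h with
      | exitLeft hF hz => exact Or.inr (Or.inr (Or.inl (Or.inl ⟨hF, hy, hz⟩)))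
      | crossRight hF hz h =>
        obtain ⟨t, ht, h⟩ := h.decompose.1 rfl hz
        rcases h with h | ⟨q, hq, hqy⟩
        · exact Or.inl ⟨t, ⟨_, ⟨hF, hy, hz⟩, ht⟩, h⟩
        · exact Or.inr (Or.inr (Or.inl (Or.inr ⟨q, ⟨t, ⟨_, ⟨hF, hy, hz⟩, ht⟩, hq⟩, hqy⟩)))
    · cases h with
      | exitRight hF hz => exact Or.inr (Or.inr (Or.inr (Or.inl ⟨hF, hy, hz⟩)))
      | crossLeft hF hz h =>
        obtain ⟨t, ht, h⟩ := h.decompose.2 rfl hz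
        rcases h with h | ⟨q, hq, hqy⟩
        · exact Or.inr (Or.inl ⟨t, ⟨_, ⟨hF, hy, hz⟩, ht⟩, h⟩)
        · exact Or.inr (Or.inr (Or.inr (Or.inr ⟨q, ⟨t, ⟨_, ⟨hF, hy, hz⟩, ht⟩, hq⟩, hqy⟩)))

/-! ### Flows of sequences of slots -/

/-- A single step between locations: an edge of one of the relations `X s` with `a ≤ s < b`,
where slot `s` lies between the positions `s` and `s + 1`. -/
def SlotStep (X : ℕ → ℕ → ℕ → Prop) (a b : ℕ) (u v : ℕ × ℕ) : Prop :=
  ∃ s, a ≤ s ∧ s < b ∧ X s u.2 v.2 ∧ u.1 = s + u.2 % 2 ∧ v.1 + v.2 % 2 = s + 1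

/-- The location of `[a, b]` with level `y` at which factors start. -/
def entryLoc (a b y : ℕ) : ℕ × ℕ := (if Even y then a else b, y)

/-- The location of `[a, b]` with level `y` at which factors end. -/
def exitLoc (a b y : ℕ) : ℕ × ℕ := (if Even y then b else a, y)

/-- The flow on `[a, b]` induced by the relations `X s`, for `a ≤ s < b`. -/
def slotFlow (X : ℕ → ℕ → ℕ → Prop) (a b y y' : ℕ) : Prop :=
  TransGen (SlotStep X a b) (entryLoc a b y) (exitLoc a b y')

variable {X : ℕ → ℕ → ℕ → Prop}

lemma SlotStep.mono {a b a' b' : ℕ} (ha : a' ≤ a) (hb : b ≤ b') {u v : ℕ × ℕ}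
    (h : SlotStep X a b u v) : SlotStep X a' b' u v := by
  obtain ⟨s, h1, h2, h⟩ := h
  exact ⟨s, ha.trans h1, h2.trans_le hb, h⟩

lemma exitLoc_even {a b y : ℕ} (h : Even y) : exitLoc a b y = (b, y) := by simp [exitLoc, h]

lemma exitLoc_odd {a b y : ℕ} (h : Odd y) : exitLoc a b y = (a, y) := by
  simp [exitLoc, Nat.not_even_iff_odd.2 h]

lemma entryLoc_even {a b y : ℕ} (h : Even y) : entryLoc a b y = (a, y) := by simp [entryLoc, h]

lemma entryLoc_odd {a b y : ℕ} (h : Odd y) : entryLoc a b y = (b, y) := by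
  simp [entryLoc, Nat.not_even_iff_odd.2 h]

lemma transGen_of_flowWalk {a b c : ℕ} (hab : a ≤ b) (hbc : b ≤ c) {s : Bool} {y y' : ℕ}
    (h : FlowWalk (slotFlow X a b) (slotFlow X b c) s y y') :
    TransGen (SlotStep X a c) (if s then entryLoc b c y else entryLoc a b y)
      (exitLoc a c y') := by
  have hl : ∀ y z, slotFlow X a b y z → TransGen (SlotStep X a c) (entryLoc a b y) (exitLoc a b z) :=
    fun y z h => TransGen.mono (fun _ _ huv => SlotStep.mono le_rfl hbc huv) _ _ h
  have hr : ∀ y z, slotFlow X b c y z → TransGen (SlotStep X a c) (entryLoc b c y) (exitLoc b c z) :=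
    fun y z h => TransGen.mono (fun _ _ huv => SlotStep.mono hab le_rfl huv) _ _ h
  induction h with
  | exitLeft hF hz => simpa [exitLoc_odd hz] using hl _ _ hF
  | exitRight hF hz => simpa [exitLoc_even hz] using hr _ _ hF
  | crossRight hF hz _ ih =>
    have := hl _ _ hF
    rw [exitLoc_even hz] at this
    simp only [if_true, entryLoc_even hz] at ih
    exact this.trans ih
  | crossLeft hF hz _ ih =>
    have := hr _ _ hF
    rw [exitLoc_odd hz] at this
    simp only [entryLoc_odd hz] at ih
    exact this.trans ih

/-- A path is cut where it first leaves the half that it starts in. From the location `u` the next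
slot is `u.1 - u.2 % 2`, because even levels look to the right and odd levels to the left. The
comparison of `u.1` with `b + u.2 % 2` therefore tells the half. -/
lemma flowWalk_of_transGen {a b c : ℕ} (hab : a < b) (hbc : b < c) {u : ℕ × ℕ} {y' : ℕ}
    (h : TransGen (SlotStep X a c) u (exitLoc a c y')) :
    (u.1 < b + u.2 % 2 → ∃ z, TransGen (SlotStep X a b) u (exitLoc a b z) ∧
      (Odd z ∧ y' = z ∨ Even z ∧ FlowWalk (slotFlow X a b) (slotFlow X b c) true z y')) ∧
    (b + u.2 % 2 ≤ u.1 → ∃ z, TransGen (SlotStep X b c) u (exitLoc b c z) ∧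
      (Even z ∧ y' = z ∨ Odd z ∧ FlowWalk (slotFlow X a b) (slotFlow X b c) false z y')) := by
  induction h using TransGen.head_induction_on with
  | @single u h =>
    obtain ⟨s, hs1, hs2, hX, h1, h2⟩ := h
    refine ⟨fun hu => ⟨y', ?_⟩, fun hu => ⟨y', ?_⟩⟩ <;> rcases Nat.even_or_odd y' with hy | hy
    · rw [exitLoc_even hy] at h2
      have := Nat.even_iff.1 hy
      simp only at h2; omega
    · refine ⟨.single ⟨s, hs1, by omega, ?_⟩, Or.inl ⟨hy, rfl⟩⟩
      rw [exitLoc_odd hy] at *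
      exact ⟨hX, h1, h2⟩
    · refine ⟨.single ⟨s, by omega, hs2, ?_⟩, Or.inl ⟨hy, rfl⟩⟩
      rw [exitLoc_even hy] at *
      exact ⟨hX, h1, h2⟩
    · rw [exitLoc_odd hy] at h2
      have := Nat.odd_iff.1 hy
      simp only at h2; omega
  | @head u v h hv ih =>
    obtain ⟨s, hs1, hs2, hX, h1, h2⟩ := h
    have hslot : a ≤ v.1 - v.2 % 2 ∧ v.1 - v.2 % 2 < c := by
      obtain ⟨w, ⟨s', h1', h2', _, h3', _⟩, _⟩ := TransGen.head'_iff.1 hv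
      omega
    refine ⟨fun hu => ?_, fun hu => ?_⟩
    · have hstep : SlotStep X a b u v := ⟨s, hs1, by omega, hX, h1, h2⟩
      by_cases hvb : v.1 < b + v.2 % 2
      · obtain ⟨z, hz, hz'⟩ := ih.1 hvb
        exact ⟨z, hz.head hstep, hz'⟩
      · obtain ⟨z, hz, hz'⟩ := ih.2 (by omega)
        have hv0 : v.2 % 2 = 0 := by omega
        have he : Even v.2 := Nat.even_iff.2 hv0
        have hve : v = (b, v.2) := Prod.ext (by simp only; omega) rfl
        have hF : slotFlow X b c v.2 z := by
          rw [slotFlow, entryLoc_even he, ← hve]; exact hz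
        refine ⟨v.2, ?_, Or.inr ⟨he, ?_⟩⟩
        · rw [exitLoc_even he, ← hve]; exact .single hstep
        · rcases hz' with ⟨hz0, rfl⟩ | ⟨hz0, hw⟩
          · exact .exitRight hF hz0
          · exact .crossLeft hF hz0 hw
    · have hstep : SlotStep X b c u v := ⟨s, by omega, hs2, hX, h1, h2⟩
      by_cases hvb : b + v.2 % 2 ≤ v.1
      · obtain ⟨z, hz, hz'⟩ := ih.2 hvb
        exact ⟨z, hz.head hstep, hz'⟩
      · obtain ⟨z, hz, hz'⟩ := ih.1 (by omega)
        have hv0 : v.2 % 2 = 1 := by omega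
        have he : Odd v.2 := Nat.odd_iff.2 hv0
        have hve : v = (b, v.2) := Prod.ext (by simp only; omega) rfl
        have hF : slotFlow X a b v.2 z := by
          rw [slotFlow, entryLoc_odd he, ← hve]; exact hz
        refine ⟨v.2, ?_, Or.inr ⟨he, ?_⟩⟩
        · rw [exitLoc_odd he, ← hve]; exact .single hstep
        · rcases hz' with ⟨hz0, rfl⟩ | ⟨hz0, hw⟩
          · exact .exitLeft hF hz0
          · exact .crossRight hF hz0 hw

theorem slotFlow_eq_flowComp {a b c : ℕ} (hab : a < b) (hbc : b < c) :
    slotFlow X a c = flowComp (slotFlow X a b) (slotFlow X b c) := by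
  ext y y'
  rw [flowComp_iff]
  constructor
  · intro h
    have hw := flowWalk_of_transGen hab hbc h
    rcases Nat.even_or_odd y with hy | hy
    · refine Or.inl ⟨hy, ?_⟩
      rw [entryLoc_even hy] at hw
      obtain ⟨z, hz, hz'⟩ := hw.1 (by simp only; omega)
      have hF : slotFlow X a b y z := by rw [slotFlow, entryLoc_even hy]; exact hz
      rcases hz' with ⟨hz0, rfl⟩ | ⟨hz0, hw⟩
      · exact .exitLeft hF hz0
      · exact .crossRight hF hz0 hw
    · refine Or.inr ⟨hy, ?_⟩
      rw [entryLoc_odd hy] at hw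
      obtain ⟨z, hz, hz'⟩ := hw.2 (by simp only; omega)
      have hF : slotFlow X b c y z := by rw [slotFlow, entryLoc_odd hy]; exact hz
      rcases hz' with ⟨hz0, rfl⟩ | ⟨hz0, hw⟩
      · exact .exitRight hF hz0
      · exact .crossLeft hF hz0 hw
  · rintro (⟨hy, h⟩ | ⟨hy, h⟩)
    · have := transGen_of_flowWalk hab.le hbc.le h
      rw [slotFlow, entryLoc_even hy]
      simpa [entryLoc_even hy] using this
    · have := transGen_of_flowWalk hab.le hbc.le h
      rw [slotFlow, entryLoc_odd hy]
      simpa [entryLoc_odd hy] using this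

lemma slotFlow_succ (a : ℕ) : slotFlow X a (a + 1) = X a := by
  ext y y'
  constructor
  · intro h
    obtain ⟨v, ⟨s, h1, h2, h3, h4, h5⟩, hv⟩ := TransGen.head'_iff.1 h
    obtain rfl : s = a := by omega
    rcases ReflTransGen.cases_head hv with rfl | ⟨w, ⟨s', h1', h2', h3', h4', h5'⟩, _⟩
    · exact h3
    · omega
  · intro h
    refine .single ⟨a, le_rfl, by omega, h, ?_, ?_⟩
    · rcases Nat.even_or_odd y with hy | hy
      · simp [entryLoc_even hy, Nat.even_iff.1 hy]
      · simp [entryLoc_odd hy, Nat.odd_iff.1 hy]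
    · rcases Nat.even_or_odd y' with hy | hy
      · simp [exitLoc_even hy, Nat.even_iff.1 hy]
      · simp [exitLoc_odd hy, Nat.odd_iff.1 hy]

/-- Arbitrary relations are realized as the steps of three adjacent slots. Both bracketings then
describe the paths through `[0, 3]`. -/
theorem flowComp_assoc (F₀ F₁ F₂ : ℕ → ℕ → Prop) :
    flowComp (flowComp F₀ F₁) F₂ = flowComp F₀ (flowComp F₁ F₂) := by
  let X : ℕ → ℕ → ℕ → Prop := fun s => if s = 0 then F₀ else if s = 1 then F₁ else F₂
  have h0 : slotFlow X 0 1 = F₀ := slotFlow_succ 0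
  have h1 : slotFlow X 1 2 = F₁ := slotFlow_succ 1
  have h2 : slotFlow X 2 3 = F₂ := slotFlow_succ 2
  rw [← h0, ← h1, ← h2, ← slotFlow_eq_flowComp (by norm_num) (by norm_num),
    ← slotFlow_eq_flowComp (by norm_num) (by norm_num),
    ← slotFlow_eq_flowComp (by norm_num) (by norm_num),
    ← slotFlow_eq_flowComp (by norm_num) (by norm_num)]

/-! ### A finite semigroup of effects -/

/-- Both ends of every edge of `F` are smaller than `h`. -/
def FlowBounded (h : ℕ) (F : ℕ → ℕ → Prop) : Prop := ∀ y y', F y y' → y < h ∧ y' < h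

lemma FlowBounded.flowWalk {h : ℕ} (hF : FlowBounded h F) (hF' : FlowBounded h F') {s : Bool}
    {y y' : ℕ} (hw : FlowWalk F F' s y y') : y < h ∧ y' < h := by
  induction hw with
  | exitLeft h _ => exact hF _ _ h
  | exitRight h _ => exact hF' _ _ h
  | crossRight h _ _ ih => exact ⟨(hF _ _ h).1, ih.2⟩
  | crossLeft h _ _ ih => exact ⟨(hF' _ _ h).1, ih.2⟩

lemma FlowBounded.flowComp {h : ℕ} (hF : FlowBounded h F) (hF' : FlowBounded h F') :
    FlowBounded h (flowComp F F') := by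
  intro y y' hy
  rcases flowComp_iff.1 hy with ⟨_, hw⟩ | ⟨_, hw⟩ <;> exact hF.flowWalk hF' hw

/-- Flows with nodes below `h` together with a left and a right end in `S`. -/
@[ext]
structure BoundedEffect (h : ℕ) (S : Type*) where
  flow : {F : ℕ → ℕ → Prop // FlowBounded h F}
  left : S
  right : S

/-- The product does not test whether the inner ends agree, so it is total. Only products of
adjacent intervals are formed, where they do agree. -/
instance (h : ℕ) (S : Type*) : Semigroup (BoundedEffect h S) where
  mul E E' := ⟨⟨flowComp E.flow.1 E'.flow.1, E.flow.2.flowComp E'.flow.2⟩, E.left, E'.right⟩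
  mul_assoc E E' E'' := by
    refine BoundedEffect.ext (Subtype.ext ?_) rfl rfl
    exact flowComp_assoc _ _ _

lemma BoundedEffect.mul_def {h : ℕ} {S : Type*} (E E' : BoundedEffect h S) :
    E * E' = ⟨⟨flowComp E.flow.1 E'.flow.1, E.flow.2.flowComp E'.flow.2⟩, E.left, E'.right⟩ := rfl

instance (h : ℕ) : Finite {F : ℕ → ℕ → Prop // FlowBounded h F} := by
  refine Finite.of_injective (β := Fin h → Fin h → Prop) (fun F i j => F.1 i j) ?_
  intro F F' hFF
  apply Subtype.ext
  have key : ∀ F F' : {F : ℕ → ℕ → Prop // FlowBounded h F},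
      ((fun (i j : Fin h) => F.1 i j) = fun (i j : Fin h) => F'.1 i j) → ∀ y y', F.1 y y' → F'.1 y y' := by
    intro F F' e y y' hy
    obtain ⟨h1, h2⟩ := F.2 _ _ hy
    exact (congrFun (congrFun e ⟨y, h1⟩) ⟨y', h2⟩).mp hy
  ext y y'
  exact ⟨key F F' hFF y y', key F' F hFF.symm y y'⟩

instance (h : ℕ) (S : Type*) [Finite S] : Finite (BoundedEffect h S) := by
  refine Finite.of_injective
    (β := {F : ℕ → ℕ → Prop // FlowBounded h F} × S × S) (fun E => (E.flow, E.left, E.right)) ?_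
  intro E E' h
  simp only [Prod.mk.injEq] at h
  exact BoundedEffect.ext h.1 h.2.1 h.2.2

instance (S : Type*) [Finite S] : Finite (WithOne S) := inferInstanceAs (Finite (Option S))

end FlowComp

end TwoWay

/-! ### Head trajectories: parity of levels, intercepted segments, flows -/

namespace TwoWay

/-- The trajectory of the head in a run that crosses the whole input of length `N`: the places of
the head and the positions of the configurations at the times `0, …, len`. -/
structure HeadPath (N : ℕ) where
  len : ℕ
  hd : ℕ → ℕ
  ps : ℕ → ℕ
  hd_zero : hd 0 = 0
  ps_zero : ps 0 = 0
  step : ∀ k < len, (hd (k + 1) = hd k + 1 ∧ ps (k + 1) = hd k + 1) ∨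
    (hd (k + 1) + 1 = hd k ∧ ps (k + 1) = hd k)
  hd_lt : ∀ k < len, hd k < N
  hd_len : hd len = N

namespace HeadPath

variable {N : ℕ} (P : HeadPath N)

/-- The number of visits to position `x` before time `i`. -/
def cnt (x i : ℕ) : ℕ := Nat.count (fun j => P.ps j = x) i

/-- The level of the configuration at time `i`. -/
def lv (i : ℕ) : ℕ := P.cnt (P.ps i) i

/-- The length of the crossing sequence at position `x`. -/
def height (x : ℕ) : ℕ := P.cnt x (P.len + 1)

lemma cnt_succ (x i : ℕ) : P.cnt x (i + 1) = P.cnt x i + if P.ps i = x then 1 else 0 :=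
  Nat.count_succ _ _

/-- Each visit to `x` is a crossing of the border before the letter at place `x`, so the head
changes sides exactly at visits. The start counts as a visit to `0`. -/
lemma cnt_succ_odd (x : ℕ) {i : ℕ} (hi : i ≤ P.len) :
    P.cnt x (i + 1) % 2 = 1 ↔ x ≤ P.hd i := by
  induction i with
  | zero =>
    have h0 : P.cnt x 0 = 0 := by simp [cnt]
    have h1 := P.ps_zero
    rw [cnt_succ, h0, P.hd_zero]
    split_ifs
    · omega
    · rw [h1] at *
      simp only [false_iff]
      omega
  | succ i ih =>
    have ih := ih (by omega)
    rw [cnt_succ]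
    rcases P.step i (by omega) with ⟨h1, h2⟩ | ⟨h1, h2⟩ <;> split_ifs <;> omega

lemma cnt_ps_succ (i : ℕ) : P.cnt (P.ps i) (i + 1) = P.lv i + 1 := by
  rw [cnt_succ, if_pos rfl]; rfl

/-- Even levels are reached by moving right (or are the start), odd levels by moving left. All later
parity arguments rest on this. -/
lemma ps_eq {i : ℕ} (hi : i ≤ P.len) : P.ps i = P.hd i + P.lv i % 2 := by
  have h := P.cnt_succ_odd (P.ps i) hi
  rw [cnt_ps_succ] at h
  have : P.ps i = P.hd i ∨ P.ps i = P.hd i + 1 := by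
    rcases i with _ | i
    · left; rw [P.ps_zero, P.hd_zero]
    · rcases P.step i (by omega) with ⟨h1, h2⟩ | ⟨h1, h2⟩ <;> omega
  omega

lemma lv_lt_of_lt {i j : ℕ} (hij : i < j) (h : P.ps i = P.ps j) : P.lv i < P.lv j := by
  rw [lv, lv, h]
  exact Nat.count_strict_mono (p := fun k => P.ps k = P.ps j) h hij

lemma lt_of_lv_lt {i j : ℕ} (hij : P.lv i < P.lv j) (h : P.ps i = P.ps j) : i < j := by
  rcases lt_trichotomy i j with h' | rfl | h'
  · exact h'
  · exact absurd hij (lt_irrefl _)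
  · exact absurd (P.lv_lt_of_lt h' h.symm) (by omega)

lemma loc_inj {i j : ℕ} (h : P.ps i = P.ps j) (h' : P.lv i = P.lv j) : i = j := by
  rcases lt_trichotomy i j with hij | hij | hij
  · exact absurd (P.lv_lt_of_lt hij h) (by omega)
  · exact hij
  · exact absurd (P.lv_lt_of_lt hij h.symm) (by omega)

lemma lv_lt_height {i : ℕ} (hi : i ≤ P.len) : P.lv i < P.height (P.ps i) :=
  Nat.count_strict_mono (p := fun k => P.ps k = P.ps i) rfl (by omega)

lemma exists_loc {x y : ℕ} (hy : y < P.height x) : ∃ i ≤ P.len, P.ps i = x ∧ P.lv i = y := by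
  have key : ∀ n, y < P.cnt x n → ∃ i < n, P.ps i = x ∧ P.lv i = y := by
    intro n
    induction n with
    | zero => intro h; simp [cnt] at h
    | succ n ih =>
      intro h
      by_cases hn : y < P.cnt x n
      · obtain ⟨i, hi, h⟩ := ih hn
        exact ⟨i, by omega, h⟩
      · rw [cnt_succ] at h
        split_ifs at h with hp
        · refine ⟨n, by omega, hp, ?_⟩
          rw [lv, hp]; omega
        · omega
  obtain ⟨i, hi, h⟩ := key _ hy
  exact ⟨i, by omega, h⟩

lemma height_odd {x : ℕ} (hx : x ≤ N) : P.height x % 2 = 1 :=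
  (P.cnt_succ_odd x le_rfl).2 (by rw [P.hd_len]; exact hx)

lemma hd_succ_add {k : ℕ} (hk : k < P.len) : P.ps (k + 1) + P.lv (k + 1) % 2 = P.hd k + 1 := by
  have := P.ps_eq (i := k + 1) (by omega)
  rcases P.step k hk with ⟨h1, h2⟩ | ⟨h1, h2⟩ <;> omega

/-! ### Segments -/

/-- The factor from time `i` to time `j` is a maximal factor reading letters between the
positions `a` and `b`. -/
structure Seg (a b i j : ℕ) : Prop where
  lt : i < j
  le : j ≤ P.len
  mem : ∀ k, i ≤ k → k < j → a ≤ P.hd k ∧ P.hd k < b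
  entry : ∀ k, k + 1 = i → ¬ (a ≤ P.hd k ∧ P.hd k < b)
  exit : ¬ (a ≤ P.hd j ∧ P.hd j < b)

variable {P} {a b i j : ℕ}

/-- The preceding transition reads a letter outside the interval and the first one a letter inside.
The interval is thus entered at `a` by a right move, at `b` by a left move, or at the start of the
run. -/
lemma Seg.start_loc (h : P.Seg a b i j) : (P.ps i, P.lv i) = entryLoc a b (P.lv i) := by
  have h1 := h.lt
  have h2 := h.le
  have hi := P.ps_eq (i := i) (by omega)
  have hm := h.mem i le_rfl h1
  rcases i with _ | k
  · have h0 : P.lv 0 = 0 := by simp [lv, cnt]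
    have := P.hd_zero
    rw [h0, entryLoc_even (by simp), P.ps_zero, Prod.mk.injEq]
    omega
  · have he := h.entry k rfl
    have hs := P.step k (by omega)
    rcases Nat.even_or_odd (P.lv (k + 1)) with hp | hp
    · rw [entryLoc_even hp, Prod.mk.injEq]
      rw [Nat.even_iff] at hp
      omega
    · rw [entryLoc_odd hp, Prod.mk.injEq]
      rw [Nat.odd_iff] at hp
      omega

lemma Seg.end_loc (h : P.Seg a b i j) : (P.ps j, P.lv j) = exitLoc a b (P.lv j) := by
  have h1 := h.lt
  have h2 := h.le
  have hj := P.ps_eq (i := j) (by omega)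
  obtain ⟨k, rfl⟩ : ∃ k, j = k + 1 := ⟨j - 1, by omega⟩
  have hm := h.mem k (by omega) (by omega)
  have he := h.exit
  have hs := P.step k (by omega)
  rcases Nat.even_or_odd (P.lv (k + 1)) with hp | hp
  · rw [exitLoc_even hp, Prod.mk.injEq]
    rw [Nat.even_iff] at hp
    omega
  · rw [exitLoc_odd hp, Prod.mk.injEq]
    rw [Nat.odd_iff] at hp
    omega

lemma Seg.ps_start_even (h : P.Seg a b i j) (hp : Even (P.lv i)) : P.ps i = a := by
  have := h.start_loc
  rw [entryLoc_even hp] at this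
  exact congrArg Prod.fst this

lemma Seg.ps_start_odd (h : P.Seg a b i j) (hp : Odd (P.lv i)) : P.ps i = b := by
  have := h.start_loc
  rw [entryLoc_odd hp] at this
  exact congrArg Prod.fst this

lemma Seg.ps_end_even (h : P.Seg a b i j) (hp : Even (P.lv j)) : P.ps j = b := by
  have := h.end_loc
  rw [exitLoc_even hp] at this
  exact congrArg Prod.fst this

lemma Seg.ps_end_odd (h : P.Seg a b i j) (hp : Odd (P.lv j)) : P.ps j = a := by
  have := h.end_loc
  rw [exitLoc_odd hp] at this
  exact congrArg Prod.fst this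

lemma Seg.ps_start (h : P.Seg a b i j) : P.ps i = a ∨ P.ps i = b := by
  rcases Nat.even_or_odd (P.lv i) with hp | hp
  · exact Or.inl (h.ps_start_even hp)
  · exact Or.inr (h.ps_start_odd hp)

lemma Seg.ps_end (h : P.Seg a b i j) : P.ps j = a ∨ P.ps j = b := by
  rcases Nat.even_or_odd (P.lv j) with hp | hp
  · exact Or.inr (h.ps_end_even hp)
  · exact Or.inl (h.ps_end_odd hp)

lemma Seg.ps_mid (h : P.Seg a b i j) {k : ℕ} (hik : i < k) (hkj : k < j) :
    a < P.ps k ∧ P.ps k < b := by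
  have h2 := h.le
  obtain ⟨k, rfl⟩ : ∃ l, k = l + 1 := ⟨k - 1, by omega⟩
  have h3 := h.mem k (by omega) (by omega)
  have h4 := h.mem (k + 1) (by omega) (by omega)
  have := P.step k (by omega)
  omega

lemma Seg.unique {i' j' k : ℕ} (h : P.Seg a b i j) (h' : P.Seg a b i' j') (hk : i ≤ k)
    (hk' : k < j) (hk2 : i' ≤ k) (hk2' : k < j') : i = i' ∧ j = j' := by
  have key : ∀ {i j i' j'}, P.Seg a b i j → P.Seg a b i' j' → i ≤ k → k < j → i' ≤ k → k < j' →
      i ≤ i' ∧ j ≤ j' := by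
    intro i j i' j' h h' hk hk' hk2 hk2'
    constructor
    · by_contra hlt
      obtain ⟨l, rfl⟩ : ∃ l, i = l + 1 := ⟨i - 1, by omega⟩
      exact h.entry l rfl (h'.mem l (by omega) (by omega))
    · by_contra hlt
      exact h'.exit (h.mem j' (by omega) (by omega))
  have h1 := key h h' hk hk' hk2 hk2'
  have h2 := key h' h hk2 hk2' hk hk'
  omega

/-- A maximal extension in both directions; forwards it stops because the run ends with the head at
place `N ≥ b`. -/
lemma exists_seg (hb : b ≤ N) {k : ℕ} (hk : k < P.len) (hm : a ≤ P.hd k ∧ P.hd k < b) :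
    ∃ i j, P.Seg a b i j ∧ i ≤ k ∧ k < j := by
  classical
  have hex : ∃ j, k ≤ j ∧ ¬ (a ≤ P.hd j ∧ P.hd j < b) :=
    ⟨P.len, hk.le, by rw [P.hd_len]; omega⟩
  have hex' : ∃ i, ∀ l, i ≤ l → l ≤ k → (a ≤ P.hd l ∧ P.hd l < b) := ⟨k, fun l h1 h2 => by
    obtain rfl : l = k := by omega
    exact hm⟩
  have hj := Nat.find_spec hex
  have hjmin := fun m => Nat.find_min hex (m := m)
  have hjle : Nat.find hex ≤ P.len := Nat.find_min' hex ⟨hk.le, by rw [P.hd_len]; omega⟩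
  have hi := Nat.find_spec hex'
  have himin := fun m => Nat.find_min hex' (m := m)
  have hile : Nat.find hex' ≤ k := Nat.find_min' hex' (fun l h1 h2 => by
    obtain rfl : l = k := by omega
    exact hm)
  set j := Nat.find hex
  set i := Nat.find hex'
  have hkj : k < j := lt_of_le_of_ne hj.1 (by rintro h; rw [← h] at hj; exact hj.2 hm)
  refine ⟨i, j, ⟨by omega, hjle, ?_, ?_, hj.2⟩, hile, hkj⟩
  · intro l h1 h2
    by_cases hl : l ≤ k
    · exact hi l h1 hl
    · by_contra hn
      exact hjmin l h2 ⟨by omega, hn⟩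
  · intro l hl hml
    refine himin l (by omega) fun m h1 h2 => ?_
    rcases h1.eq_or_lt with rfl | h1
    · exact hml
    · exact hi m (by omega) h2

lemma exists_seg_start (hab : a < b) (hb : b ≤ N) (hi : i ≤ P.len)
    (h : (P.ps i, P.lv i) = entryLoc a b (P.lv i)) : ∃ j, P.Seg a b i j := by
  have he := P.ps_eq hi
  have hm : a ≤ P.hd i ∧ P.hd i < b ∧ (P.ps i = a ∨ P.ps i = b) := by
    rcases Nat.even_or_odd (P.lv i) with hp | hp
    · rw [entryLoc_even hp, Prod.mk.injEq] at h
      rw [Nat.even_iff] at hp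
      omega
    · rw [entryLoc_odd hp, Prod.mk.injEq] at h
      rw [Nat.odd_iff] at hp
      omega
  have hlt : i < P.len := by
    rcases hi.eq_or_lt with rfl | h
    · have := P.hd_len; omega
    · exact h
  obtain ⟨i', j, hs, h1, h2⟩ := exists_seg hb hlt ⟨hm.1, hm.2.1⟩
  rcases h1.eq_or_lt with rfl | h1
  · exact ⟨j, hs⟩
  · have := hs.ps_mid h1 h2
    omega

lemma exists_seg_end (hab : a < b) (hb : b ≤ N) (hj : j ≤ P.len)
    (h : (P.ps j, P.lv j) = exitLoc a b (P.lv j)) : ∃ i, P.Seg a b i j := by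
  have he := P.ps_eq hj
  have hne : j ≠ 0 := by
    rintro rfl
    have h0 : P.lv 0 = 0 := by simp [lv, cnt]
    rw [h0, exitLoc_even (by simp), P.ps_zero, Prod.mk.injEq] at h
    omega
  obtain ⟨k, rfl⟩ : ∃ k, j = k + 1 := ⟨j - 1, by omega⟩
  have hs := P.step k (by omega)
  have hm : (a ≤ P.hd k ∧ P.hd k < b) ∧ (P.ps (k + 1) = a ∨ P.ps (k + 1) = b) := by
    rcases Nat.even_or_odd (P.lv (k + 1)) with hp | hp
    · rw [exitLoc_even hp, Prod.mk.injEq] at h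
      rw [Nat.even_iff] at hp
      omega
    · rw [exitLoc_odd hp, Prod.mk.injEq] at h
      rw [Nat.odd_iff] at hp
      omega
  obtain ⟨i, j', hs, h1, h2⟩ := exists_seg hb (by omega : k < P.len) hm.1
  rcases (show k + 1 ≤ j' from h2).eq_or_lt with h3 | h3
  · exact ⟨i, h3 ▸ hs⟩
  · have := hs.ps_mid (k := k + 1) (by omega) h3
    omega

/-! ### The flow of an interval -/

/-- The edges of the flow of `[a, b]`. -/
def flow (P : HeadPath N) (a b y y' : ℕ) : Prop :=
  ∃ i j, P.Seg a b i j ∧ P.lv i = y ∧ P.lv j = y'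

/-- The flow of a single letter. -/
def letterFlow (P : HeadPath N) (s y y' : ℕ) : Prop :=
  ∃ k < P.len, P.hd k = s ∧ P.lv k = y ∧ P.lv (k + 1) = y'

lemma slotStep_letterFlow {u v : ℕ × ℕ} : SlotStep P.letterFlow a b u v ↔
    ∃ k < P.len, (a ≤ P.hd k ∧ P.hd k < b) ∧ u = (P.ps k, P.lv k) ∧
      v = (P.ps (k + 1), P.lv (k + 1)) := by
  obtain ⟨u1, u2⟩ := u
  obtain ⟨v1, v2⟩ := v
  simp only [Prod.mk.injEq]
  constructor
  · rintro ⟨s, h1, h2, ⟨k, hk, rfl, rfl, rfl⟩, h3, h4⟩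
    have := P.ps_eq hk.le
    have := P.hd_succ_add hk
    exact ⟨k, hk, ⟨h1, h2⟩, ⟨by omega, rfl⟩, ⟨by omega, rfl⟩⟩
  · rintro ⟨k, hk, ⟨h1, h2⟩, ⟨rfl, rfl⟩, ⟨rfl, rfl⟩⟩
    exact ⟨P.hd k, h1, h2, ⟨k, hk, rfl, rfl, rfl⟩, P.ps_eq hk.le, P.hd_succ_add hk⟩

lemma transGen_letterFlow {u v : ℕ × ℕ} :
    Relation.TransGen (SlotStep P.letterFlow a b) u v ↔ ∃ i j, i < j ∧ j ≤ P.len ∧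
      (∀ k, i ≤ k → k < j → a ≤ P.hd k ∧ P.hd k < b) ∧
      u = (P.ps i, P.lv i) ∧ v = (P.ps j, P.lv j) := by
  constructor
  · intro h
    induction h with
    | single h =>
      obtain ⟨k, hk, hm, h1, h2⟩ := slotStep_letterFlow.1 h
      refine ⟨k, k + 1, by omega, by omega, fun l h1 h2 => ?_, h1, h2⟩
      obtain rfl : l = k := by omega
      exact hm
    | tail _ h ih =>
      obtain ⟨k, hk, hm, h1, h2⟩ := slotStep_letterFlow.1 h
      obtain ⟨i, j, hij, hj, hmem, hu, hv⟩ := ih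
      have hv := hv.symm.trans h1
      rw [Prod.mk.injEq] at hv
      obtain rfl := P.loc_inj hv.1 hv.2
      refine ⟨i, j + 1, by omega, by omega, fun l h1 h2 => ?_, hu, h2⟩
      rcases (Nat.lt_succ_iff.1 h2).eq_or_lt with rfl | h3
      · exact hm
      · exact hmem l h1 h3
  · rintro ⟨i, j, hij, hj, hmem, rfl, rfl⟩
    induction j, hij using Nat.le_induction with
    | base =>
      exact .single (slotStep_letterFlow.2 ⟨i, by omega, hmem i le_rfl (by omega), rfl, rfl⟩)
    | succ j hij ih =>
      refine .tail (ih (by omega) fun k h1 h2 => hmem k h1 (by omega)) ?_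
      exact slotStep_letterFlow.2 ⟨j, by omega, hmem j (by omega) (by omega), rfl, rfl⟩

/-- Locations determine times, so abstract paths of letter steps are factors of the run. The entry
and exit locations express maximality. -/
lemma flow_eq_slotFlow : P.flow a b = slotFlow P.letterFlow a b := by
  ext y y'
  rw [slotFlow, transGen_letterFlow]
  constructor
  · rintro ⟨i, j, h, rfl, rfl⟩
    exact ⟨i, j, h.lt, h.le, h.mem, h.start_loc.symm, h.end_loc.symm⟩
  · rintro ⟨i, j, hij, hj, hmem, hi', hj'⟩
    have hiy : P.lv i = y := (congrArg Prod.snd hi').symm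
    have hjy : P.lv j = y' := (congrArg Prod.snd hj').symm
    subst hiy hjy
    have e1 := P.ps_eq (i := i) (by omega)
    have e2 := P.ps_eq hj
    refine ⟨i, j, ⟨hij, hj, hmem, ?_, ?_⟩, rfl, rfl⟩
    · rintro k rfl
      have hs := P.step k (by omega)
      rcases Nat.even_or_odd (P.lv (k + 1)) with hp | hp
      · rw [entryLoc_even hp, Prod.mk.injEq] at hi'
        rw [Nat.even_iff] at hp
        omega
      · rw [entryLoc_odd hp, Prod.mk.injEq] at hi'
        rw [Nat.odd_iff] at hp
        omega
    · rcases Nat.even_or_odd (P.lv j) with hp | hp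
      · rw [exitLoc_even hp, Prod.mk.injEq] at hj'
        rw [Nat.even_iff] at hp
        omega
      · rw [exitLoc_odd hp, Prod.mk.injEq] at hj'
        rw [Nat.odd_iff] at hp
        omega

theorem flow_eq_flowComp {c : ℕ} (hab : a < b) (hbc : b < c) :
    P.flow a c = flowComp (P.flow a b) (P.flow b c) := by
  rw [flow_eq_slotFlow, flow_eq_slotFlow, flow_eq_slotFlow,
    slotFlow_eq_flowComp hab hbc]

lemma flow_lt_left {y y' : ℕ} (h : P.flow a b y y') : y < max (P.height a) (P.height b) := by
  obtain ⟨i, j, hs, rfl, rfl⟩ := h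
  have := P.lv_lt_height (i := i) (hs.lt.le.trans hs.le)
  rcases hs.ps_start with h | h <;> rw [h] at this
  · exact lt_max_of_lt_left this
  · exact lt_max_of_lt_right this

lemma flow_lt_right {y y' : ℕ} (h : P.flow a b y y') : y' < max (P.height a) (P.height b) := by
  obtain ⟨i, j, hs, rfl, rfl⟩ := h
  have := P.lv_lt_height (i := j) hs.le
  rcases hs.ps_end with h | h <;> rw [h] at this
  · exact lt_max_of_lt_left this
  · exact lt_max_of_lt_right this

lemma exists_start_seg (hab : a < b) (hb : b ≤ N) {y : ℕ}
    (hy : Even y ∧ y < P.height a ∨ Odd y ∧ y < P.height b) :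
    ∃ i j, P.Seg a b i j ∧ P.lv i = y := by
  rcases hy with ⟨hp, hy⟩ | ⟨hp, hy⟩ <;> obtain ⟨i, hi, hx, rfl⟩ := P.exists_loc hy
  · obtain ⟨j, hj⟩ := exists_seg_start hab hb hi (by rw [entryLoc_even hp, hx])
    exact ⟨i, j, hj, rfl⟩
  · obtain ⟨j, hj⟩ := exists_seg_start hab hb hi (by rw [entryLoc_odd hp, hx])
    exact ⟨i, j, hj, rfl⟩

lemma exists_end_seg (hab : a < b) (hb : b ≤ N) {y : ℕ}
    (hy : Odd y ∧ y < P.height a ∨ Even y ∧ y < P.height b) :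
    ∃ i j, P.Seg a b i j ∧ P.lv j = y := by
  rcases hy with ⟨hp, hy⟩ | ⟨hp, hy⟩ <;> obtain ⟨j, hj, hx, rfl⟩ := P.exists_loc hy
  · obtain ⟨i, hi⟩ := exists_seg_end hab hb hj (by rw [exitLoc_odd hp, hx])
    exact ⟨i, j, hi, rfl⟩
  · obtain ⟨i, hi⟩ := exists_seg_end hab hb hj (by rw [exitLoc_even hp, hx])
    exact ⟨i, j, hi, rfl⟩

lemma Seg.eq_of_lv_start {i' j' : ℕ} (h : P.Seg a b i j) (h' : P.Seg a b i' j')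
    (hl : P.lv i = P.lv i') : i = i' ∧ j = j' := by
  have : i = i' := by
    refine P.loc_inj ?_ hl
    have e1 := h.start_loc
    rw [hl] at e1
    exact congrArg Prod.fst (e1.trans h'.start_loc.symm)
  subst this
  exact h.unique h' le_rfl h.lt le_rfl h'.lt

lemma Seg.eq_of_lv_end {i' j' : ℕ} (h : P.Seg a b i j) (h' : P.Seg a b i' j')
    (hl : P.lv j = P.lv j') : i = i' ∧ j = j' := by
  have : j = j' := by
    refine P.loc_inj ?_ hl
    have e1 := h.end_loc
    rw [hl] at e1
    exact congrArg Prod.fst (e1.trans h'.end_loc.symm)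
  subst this
  have h1 := h.lt
  have h2 := h'.lt
  exact h.unique h' (k := j - 1) (by omega) (by omega) (by omega) (by omega)

theorem isFlow (hab : a < b) (hb : b ≤ N) : IsFlow (P.height a) (P.height b) (P.flow a b) where
  node_src _ _ h := flow_lt_left h
  node_tgt _ _ h := flow_lt_right h
  out_unique := by
    rintro y y' y'' ⟨i, j, hs, h1, rfl⟩ ⟨i', j', hs', h1', rfl⟩
    rw [(hs.eq_of_lv_start hs' (h1.trans h1'.symm)).2]
  in_unique := by
    rintro y y' y'' ⟨i, j, hs, rfl, h1⟩ ⟨i', j', hs', rfl, h1'⟩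
    rw [(hs.eq_of_lv_end hs' (h1.trans h1'.symm)).1]
  left_even y hy hp := by
    obtain ⟨i, j, h, rfl⟩ := exists_start_seg hab hb (Or.inl ⟨hp, hy⟩)
    exact ⟨_, i, j, h, rfl, rfl⟩
  right_odd y hy hp := by
    obtain ⟨i, j, h, rfl⟩ := exists_start_seg hab hb (Or.inr ⟨hp, hy⟩)
    exact ⟨_, i, j, h, rfl, rfl⟩
  left_odd y hy hp := by
    obtain ⟨i, j, h, rfl⟩ := exists_end_seg hab hb (Or.inl ⟨hp, hy⟩)
    exact ⟨_, i, j, h, rfl, rfl⟩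
  right_even y hy hp := by
    obtain ⟨i, j, h, rfl⟩ := exists_end_seg hab hb (Or.inr ⟨hp, hy⟩)
    exact ⟨_, i, j, h, rfl, rfl⟩

/-- Strictly between its ends, a segment visits only interior positions. -/
lemma Seg.cnt_eq (h : P.Seg a b i j) {x : ℕ} (hx : x = a ∨ x = b) :
    P.cnt x j = P.cnt x (i + 1) := by
  have key : ∀ k, i + 1 ≤ k → k ≤ j → P.cnt x k = P.cnt x (i + 1) := by
    intro k hk
    induction k, hk using Nat.le_induction with
    | base => simp
    | succ k hk ih =>
      intro hkj
      have := h.ps_mid (k := k) (by omega) (by omega)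
      rw [cnt_succ, if_neg (by omega), ih (by omega)]; rfl
  exact key j h.lt le_rfl

/-- An edge of a flow between nodes of different parity goes from a node to its successor. -/
lemma flow_succ {y y' : ℕ} (h : P.flow a b y y') (hp : y % 2 ≠ y' % 2) : y' = y + 1 := by
  obtain ⟨i, j, hs, rfl, rfl⟩ := h
  -- A change of parity means a return to the end of entry, and these are consecutive visits to it.
  have hps : P.ps i = P.ps j := by
    rcases Nat.even_or_odd (P.lv i) with hi | hi <;> rcases Nat.even_or_odd (P.lv j) with hj | hj
    · rw [Nat.even_iff] at hi hj; omega
    · rw [hs.ps_start_even hi, hs.ps_end_odd hj]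
    · rw [hs.ps_start_odd hi, hs.ps_end_even hj]
    · rw [Nat.odd_iff] at hi hj; omega
  rw [← P.cnt_ps_succ i, lv, ← hps]
  exact hs.cnt_eq hs.ps_start

end HeadPath

end TwoWay

namespace TwoWay

/-! ### Cycles of idempotent flows -/

/-- The nodes `m, …, M` form a cycle of `F`, in which `M ↦ m` is the only edge between nodes of
the same parity. -/
structure IsFlowCycle (F : ℕ → ℕ → Prop) (m M : ℕ) : Prop where
  through : F M m
  parity : M % 2 = m % 2
  le : m ≤ M
  succ : ∀ v, m ≤ v → v < M → F v (v + 1)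

/-- The properties of the flow of an idempotent loop with crossing sequences of length `h`. -/
structure IsIdempotentFlow (h : ℕ) (F : ℕ → ℕ → Prop) : Prop where
  isFlow : IsFlow h h F
  idem : flowComp F F = F
  succ : ∀ y y', F y y' → y % 2 ≠ y' % 2 → y' = y + 1

namespace IsIdempotentFlow

variable {h : ℕ} {F : ℕ → ℕ → Prop}

lemma exists_edge (hF : IsIdempotentFlow h F) {y : ℕ} (hy : y < h) : ∃ y', F y y' := by
  rcases Nat.even_or_odd y with hp | hp
  · exact hF.isFlow.left_even y hy hp
  · exact hF.isFlow.right_odd y hy hp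

lemma exists_edge_to (hF : IsIdempotentFlow h F) {y : ℕ} (hy : y < h) : ∃ y', F y' y := by
  rcases Nat.even_or_odd y with hp | hp
  · exact hF.isFlow.right_even y hy hp
  · exact hF.isFlow.left_odd y hy hp

lemma lt_left (hF : IsIdempotentFlow h F) {y y' : ℕ} (hy : F y y') : y < h := by
  simpa using hF.isFlow.node_src _ _ hy

lemma lt_right (hF : IsIdempotentFlow h F) {y y' : ℕ} (hy : F y y') : y' < h := by
  simpa using hF.isFlow.node_tgt _ _ hy

/-- The condition on `s` says that `z` was reached by a crossing into the copy traversed next. Every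
further crossing changes the parity and so goes from `z` to `z + 1`. The last edge enters `m`, so it
starts at `M` by uniqueness of incoming edges. -/
lemma walk_chain (hF : IsIdempotentFlow h F) {M m : ℕ} (hM : F M m) {s : Bool} {z w : ℕ}
    (hw : FlowWalk F F s z w) : w = m → (s = true ↔ z % 2 = 0) →
      z ≤ M ∧ ∀ v, z ≤ v → v < M → F v (v + 1) := by
  have base : ∀ z, F z m → z ≤ M ∧ ∀ v, z ≤ v → v < M → F v (v + 1) := by
    intro z hz
    obtain rfl := hF.isFlow.in_unique _ _ _ hz hM
    exact ⟨le_rfl, fun v h1 h2 => by omega⟩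
  have step : ∀ y z, F y z → y % 2 ≠ z % 2 → (z ≤ M ∧ ∀ v, z ≤ v → v < M → F v (v + 1)) →
      y ≤ M ∧ ∀ v, y ≤ v → v < M → F v (v + 1) := by
    intro y z hyz hp ⟨h1, h2⟩
    obtain rfl := hF.succ _ _ hyz hp
    refine ⟨by omega, fun v h3 h4 => ?_⟩
    rcases h3.eq_or_lt with rfl | h3
    · exact hyz
    · exact h2 v h3 h4
  induction hw with
  | exitLeft hz _ => rintro rfl -; exact base _ hz
  | exitRight hz _ => rintro rfl -; exact base _ hz
  | crossRight hz he _ ih =>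
    intro hw hs
    rw [Nat.even_iff] at he
    simp only [Bool.false_eq_true, false_iff] at hs
    exact step _ _ hz (by omega) (ih hw (by simp [he]))
  | crossLeft hz ho _ ih =>
    intro hw hs
    rw [Nat.odd_iff] at ho
    simp only [true_iff] at hs
    exact step _ _ hz (by omega) (ih hw (by simp [ho]))

/-- An edge between nodes of the same parity closes a cycle. -/
lemma isFlowCycle (hF : IsIdempotentFlow h F) {M m : ℕ} (hM : F M m) (hp : M % 2 = m % 2) :
    IsFlowCycle F m M := by
  suffices hs : ∃ s, FlowWalk F F s m m ∧ (s = true ↔ m % 2 = 0) by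
    obtain ⟨s, hw, hs⟩ := hs
    obtain ⟨h1, h2⟩ := hF.walk_chain hM hw rfl hs
    exact ⟨hM, hp, h1, h2⟩
  -- By idempotency the edge `M ↦ m` also passes through two copies of the loop. It crosses the
  -- first copy by this same edge, which leaves a walk from `m` back to `m`.
  have hc : flowComp F F M m := by rw [hF.idem]; exact hM
  rcases flowComp_iff.1 hc with ⟨he, hw⟩ | ⟨ho, hw⟩
  · rw [Nat.even_iff] at he
    cases hw with
    | exitLeft _ h2 => rw [Nat.odd_iff] at h2; omega
    | crossRight h1 _ h3 =>
      obtain rfl := hF.isFlow.out_unique _ _ _ h1 hM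
      exact ⟨true, h3, by simp; omega⟩
  · rw [Nat.odd_iff] at ho
    cases hw with
    | exitRight _ h2 => rw [Nat.even_iff] at h2; omega
    | crossLeft h1 _ h3 =>
      obtain rfl := hF.isFlow.out_unique _ _ _ h1 hM
      exact ⟨false, h3, by simp; omega⟩

/-- Starting from `v`, successor edges lead upwards until an edge keeps the parity and closes a
cycle; the top node `h - 1` has no successor node. The cycle reaches down to `v`, as otherwise its
minimum `v + 1` would have two incoming edges. -/
lemma exists_cycle (hF : IsIdempotentFlow h F) {v : ℕ} (hv : v < h) :
    ∃ m M, IsFlowCycle F m M ∧ m ≤ v ∧ v ≤ M := by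
  obtain ⟨d, hd⟩ : ∃ d, v + d + 1 = h := ⟨h - v - 1, by omega⟩
  induction d generalizing v with
  | zero =>
    obtain ⟨w, hw⟩ := hF.exists_edge hv
    have h1 := hF.lt_right hw
    by_cases hp : v % 2 = w % 2
    · have hc := hF.isFlowCycle hw hp
      exact ⟨w, v, hc, hc.le, le_rfl⟩
    · have := hF.succ _ _ hw hp
      omega
  | succ d ih =>
    obtain ⟨w, hw⟩ := hF.exists_edge hv
    by_cases hp : v % 2 = w % 2
    · have hc := hF.isFlowCycle hw hp
      exact ⟨w, v, hc, hc.le, le_rfl⟩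
    · obtain rfl := hF.succ _ _ hw hp
      obtain ⟨m, M, hc, h1, h2⟩ := ih (v := v + 1) (by omega) (by omega)
      refine ⟨m, M, hc, ?_, by omega⟩
      by_contra hlt
      obtain rfl : m = v + 1 := by omega
      have := hF.isFlow.in_unique _ _ _ hw hc.through
      omega

lemma lt_of_cycle_lt (hF : IsIdempotentFlow h F) {m M m' M' : ℕ} (hc : IsFlowCycle F m M)
    (hc' : IsFlowCycle F m' M') (hlt : M < M') : M < m' := by
  by_contra hle
  have := hF.isFlow.out_unique _ _ _ hc.through (hc'.succ M (by omega) hlt)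
  have := hc.le
  omega

end IsIdempotentFlow

/-! ### Order of visits over positions with a common idempotent flow -/

namespace HeadPath

variable {N : ℕ} {P : HeadPath N}

open Classical in
/-- The time of the location `(x, y)`. -/
noncomputable def time (P : HeadPath N) (x y : ℕ) : ℕ :=
  if h : ∃ i ≤ P.len, P.ps i = x ∧ P.lv i = y then h.choose else 0

lemma time_spec {x y : ℕ} (hy : y < P.height x) :
    P.time x y ≤ P.len ∧ P.ps (P.time x y) = x ∧ P.lv (P.time x y) = y := by
  have h := P.exists_loc hy
  rw [time, dif_pos h]
  exact h.choose_spec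

lemma time_eq {i : ℕ} (hi : i ≤ P.len) : P.time (P.ps i) (P.lv i) = i := by
  obtain ⟨-, h1, h2⟩ := time_spec (P.lv_lt_height hi)
  exact P.loc_inj h1 h2

lemma time_lt {x y y' : ℕ} (h : y < y') (hy : y' < P.height x) : P.time x y < P.time x y' := by
  obtain ⟨-, h1, h2⟩ := time_spec (h.trans hy)
  obtain ⟨-, h3, h4⟩ := time_spec hy
  exact P.lt_of_lv_lt (by omega) (by omega)

lemma time_le {x y y' : ℕ} (h : y ≤ y') (hy : y' < P.height x) : P.time x y ≤ P.time x y' := by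
  rcases h.eq_or_lt with rfl | h
  · exact le_rfl
  · exact (time_lt h hy).le

lemma Seg.eq_time_start {a b i j : ℕ} (h : P.Seg a b i j) :
    (P.lv i % 2 = 0 → i = P.time a (P.lv i)) ∧ (P.lv i % 2 = 1 → i = P.time b (P.lv i)) := by
  have := time_eq (P := P) (i := i) (h.lt.le.trans h.le)
  constructor <;> intro hp
  · rw [h.ps_start_even (Nat.even_iff.2 hp)] at this; exact this.symm
  · rw [h.ps_start_odd (Nat.odd_iff.2 hp)] at this; exact this.symm

lemma Seg.eq_time_end {a b i j : ℕ} (h : P.Seg a b i j) :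
    (P.lv j % 2 = 0 → j = P.time b (P.lv j)) ∧ (P.lv j % 2 = 1 → j = P.time a (P.lv j)) := by
  have := time_eq (P := P) h.le
  constructor <;> intro hp
  · rw [h.ps_end_even (Nat.even_iff.2 hp)] at this; exact this.symm
  · rw [h.ps_end_odd (Nat.odd_iff.2 hp)] at this; exact this.symm

/-- All intervals between positions of `S` have the same idempotent flow `F`. -/
structure Uniform (P : HeadPath N) (S : Set ℕ) (h : ℕ) (F : ℕ → ℕ → Prop) : Prop where
  idem : IsIdempotentFlow h F
  height : ∀ p ∈ S, P.height p = h
  flow : ∀ p ∈ S, ∀ q ∈ S, p < q → P.flow p q = F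

namespace Uniform

variable {S : Set ℕ} {h : ℕ} {F : ℕ → ℕ → Prop}

/-- An edge that keeps the parity is realized by a factor crossing the whole interval, rightwards
for even nodes and leftwards for odd ones. -/
lemma time_through (hS : P.Uniform S h F) {p q : ℕ} (hp : p ∈ S) (hq : q ∈ S) (hpq : p < q)
    {y y' : ℕ} (hy : F y y') (hpar : y % 2 = y' % 2) :
    (y % 2 = 0 → P.time p y < P.time q y') ∧ (y % 2 = 1 → P.time q y < P.time p y') := by
  rw [← hS.flow p hp q hq hpq] at hy
  obtain ⟨i, j, hs, rfl, rfl⟩ := hy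
  have h1 := hs.eq_time_start
  have h2 := hs.eq_time_end
  have h3 := hs.lt
  constructor <;> intro h0
  · rw [← h1.1 h0, ← h2.1 (by omega)]; exact h3
  · rw [← h1.2 h0, ← h2.2 (by omega)]; exact h3

/-- The nodes up to the maximum of a cycle are visited before the larger nodes. -/
lemma time_lt_succ (hS : P.Uniform S h F) {p q : ℕ} (hp : p ∈ S) (hq : q ∈ S)
    {m M : ℕ} (hc : IsFlowCycle F m M) (hM : M + 1 < h) : P.time p M < P.time q (M + 1) := by
  have hF := hS.idem
  -- `M + 1` is the minimum of the next cycle and `z` its maximum. The two cycles have opposite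
  -- directions, so for `p ≠ q` one of their through edges compares the two positions in the
  -- required order.
  obtain ⟨z, hz⟩ := hF.exists_edge_to hM
  have hzh := hF.lt_left hz
  have hle := hc.le
  have hzp : z % 2 = (M + 1) % 2 := by
    by_contra hne
    obtain rfl : M = z := by have := hF.succ _ _ hz hne; omega
    have := hF.isFlow.out_unique _ _ _ hz hc.through
    omega
  have hzM : M < z := by have := (hF.isFlowCycle hz hzp).le; omega
  have hph := hS.height p hp
  have hqh := hS.height q hq
  rcases lt_trichotomy p q with hpq | rfl | hpq
  · have t1 := hS.time_through hp hq hpq hc.through hc.parity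
    have t2 := hS.time_through hp hq hpq hz hzp
    rcases Nat.mod_two_eq_zero_or_one M with h0 | h0
    · exact (t1.1 h0).trans (time_lt (by omega) (by omega))
    · exact (time_lt hzM (by omega)).trans (t2.1 (by omega))
  · exact time_lt (by omega) (by omega)
  · have t1 := hS.time_through hq hp hpq hc.through hc.parity
    have t2 := hS.time_through hq hp hpq hz hzp
    rcases Nat.mod_two_eq_zero_or_one M with h0 | h0
    · exact (time_lt hzM (by omega)).trans (t2.2 (by omega))
    · exact (t1.2 h0).trans (time_lt (by omega) (by omega))

/-- The time span of a cycle inside the interval `[p, q]`. -/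
lemma span (hS : P.Uniform S h F) {p q : ℕ} (hp : p ∈ S) (hq : q ∈ S) (hpq : p < q)
    {m M i j : ℕ} (hc : IsFlowCycle F m M) (hs : P.Seg p q i j) (hm : m ≤ P.lv i)
    (hM : P.lv i ≤ M) :
    (M % 2 = 0 → P.time p m ≤ i ∧ j ≤ P.time q M) ∧
    (M % 2 = 1 → P.time q m ≤ i ∧ j ≤ P.time p M) := by
  have hF := hS.idem
  have hedge : F (P.lv i) (P.lv j) := by
    rw [← hS.flow p hp q hq hpq]; exact ⟨i, j, hs, rfl, rfl⟩
  have hMh := hF.lt_left hc.through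
  have hph := hS.height p hp
  have hqh := hS.height q hq
  have hpar := hc.parity
  have h1 := hs.eq_time_start
  have h2 := hs.eq_time_end
  have h3 := hS.time_through hp hq hpq hc.through hpar
  -- The factor realizes either the through edge of the cycle or one of its successor edges.
  have e : P.lv i = M ∧ P.lv j = m ∨ P.lv i < M ∧ P.lv j = P.lv i + 1 := by
    rcases hM.eq_or_lt with h | h
    · rw [h] at hedge
      exact Or.inl ⟨h, hF.isFlow.out_unique _ _ _ hedge hc.through⟩
    · exact Or.inr ⟨h, hF.isFlow.out_unique _ _ _ hedge (hc.succ _ hm h)⟩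
  have ip : P.time p m ≤ P.time p (P.lv i) := time_le hm (by omega)
  have iq : P.time q m ≤ P.time q (P.lv i) := time_le hm (by omega)
  have jp : P.time p (P.lv j) ≤ P.time p M := time_le (by omega) (by omega)
  have jq : P.time q (P.lv j) ≤ P.time q M := time_le (by omega) (by omega)
  have lp : P.time p m ≤ P.time p M := time_le (by omega) (by omega)
  have lq : P.time q m ≤ P.time q M := time_le (by omega) (by omega)
  rcases Nat.mod_two_eq_zero_or_one (P.lv i) with hi | hi <;>
  rcases Nat.mod_two_eq_zero_or_one (P.lv j) with hj | hj <;>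
  simp only [hi, hj, forall_const, zero_ne_one, one_ne_zero, false_imp_iff, and_true,
    true_and] at h1 h2 <;>
  constructor <;> intro h0 <;> simp only [h0, forall_const, zero_ne_one, one_ne_zero,
    false_imp_iff, and_true, true_and] at h3 <;> omega

end Uniform

/-- The time of the anchor point of the cycle with maximum `M` inside `[p, q]`. -/
noncomputable def anchorTime (P : HeadPath N) (p q M : ℕ) : ℕ :=
  if M % 2 = 0 then P.time p M else P.time q M

namespace Uniform

variable {S : Set ℕ} {h : ℕ} {F : ℕ → ℕ → Prop}

/-- Given factors in two consecutive loops, the anchor point of one of them is between them. -/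
lemma anchor_between (hS : P.Uniform S h F) {a b c d : ℕ} (ha : a ∈ S) (hb : b ∈ S) (hcS : c ∈ S)
    (hd : d ∈ S) (hab : a < b) (hbc : b ≤ c) (hcd : c < d) {m M m' M' i j i' j' k k' : ℕ}
    (hcyc : IsFlowCycle F m M) (hs : P.Seg a b i j) (hm : m ≤ P.lv i) (hM : P.lv i ≤ M)
    (hcyc' : IsFlowCycle F m' M') (hs' : P.Seg c d i' j') (hm' : m' ≤ P.lv i')
    (hM' : P.lv i' ≤ M') (hik : i ≤ k) (hkj : k < j) (hik' : i' ≤ k') (hkj' : k' < j') :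
    P.anchorTime a b M ≤ k' ∧ k < P.anchorTime c d M' ∨
    P.anchorTime c d M' ≤ k ∧ k' < P.anchorTime a b M := by
  have hF := hS.idem
  have hMh := hF.lt_left hcyc.through
  have hMh' := hF.lt_left hcyc'.through
  have s1 := hS.span ha hb hab hcyc hs hm hM
  have s2 := hS.span hcS hd hcd hcyc' hs' hm' hM'
  -- Distinct cycles: the lower one is finished at all positions of `S` before the higher one starts
  -- at any of them.
  have sep : ∀ {m M m' M'}, IsFlowCycle F m M → IsFlowCycle F m' M' → M < M' →
      ∀ p ∈ S, ∀ q ∈ S, P.time p M < P.time q m' ∧ P.time q m' ≤ P.time q M' := by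
    intro m M m' M' h1 h2 hlt p hp q hq
    have := hF.lt_of_cycle_lt h1 h2 hlt
    have hle := h2.le
    have hM'h := hF.lt_left h2.through
    have hqh := hS.height q hq
    exact ⟨(hS.time_lt_succ hp hq h1 (by omega)).trans_le (time_le (by omega) (by omega)),
      time_le hle (by omega)⟩
  rcases lt_trichotomy M M' with hlt | heq | hlt
  · left
    have e1 := sep hcyc hcyc' hlt a ha c hcS
    have e2 := sep hcyc hcyc' hlt a ha d hd
    have e3 := sep hcyc hcyc' hlt b hb c hcS
    have e4 := sep hcyc hcyc' hlt b hb d hd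
    unfold anchorTime
    rcases Nat.mod_two_eq_zero_or_one M with p1 | p1 <;>
    rcases Nat.mod_two_eq_zero_or_one M' with p2 | p2 <;>
    simp only [p1, p2, forall_const, zero_ne_one, one_ne_zero, false_imp_iff, and_true,
      true_and, if_true, if_false] at s1 s2 ⊢ <;> omega
  -- The same cycle in both loops: it passes them from left to right if `M` is even, and from right
  -- to left if `M` is odd.
  · subst heq
    obtain rfl := hF.isFlow.out_unique _ _ _ hcyc.through hcyc'.through
    have t1 := hS.time_through ha hcS (by omega) hcyc.through hcyc.parity
    have t2 := hS.time_through hb hd (by omega) hcyc.through hcyc.parity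
    have t3 : b = c ∨ ((M % 2 = 0 → P.time b M < P.time c m) ∧
        (M % 2 = 1 → P.time c M < P.time b m)) := by
      rcases hbc.eq_or_lt with h | h
      · exact Or.inl h
      · exact Or.inr (hS.time_through hb hcS h hcyc.through hcyc.parity)
    have l1 : P.time c m ≤ P.time c M := time_le hcyc.le (by rw [hS.height c hcS]; exact hMh)
    have l2 : P.time b m ≤ P.time b M := time_le hcyc.le (by rw [hS.height b hb]; exact hMh)
    unfold anchorTime
    rcases Nat.mod_two_eq_zero_or_one M with p1 | p1 <;>
    simp only [p1, forall_const, zero_ne_one, one_ne_zero, false_imp_iff, and_true,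
      true_and, if_true, if_false] at s1 s2 t1 t2 t3 ⊢
    · left
      rcases t3 with rfl | t3 <;> omega
    · right
      rcases t3 with rfl | t3 <;> omega
  · right
    have e1 := sep hcyc' hcyc hlt c hcS a ha
    have e2 := sep hcyc' hcyc hlt c hcS b hb
    have e3 := sep hcyc' hcyc hlt d hd a ha
    have e4 := sep hcyc' hcyc hlt d hd b hb
    unfold anchorTime
    rcases Nat.mod_two_eq_zero_or_one M with p1 | p1 <;>
    rcases Nat.mod_two_eq_zero_or_one M' with p2 | p2 <;>
    simp only [p1, p2, forall_const, zero_ne_one, one_ne_zero, false_imp_iff, and_true,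
      true_and, if_true, if_false] at s1 s2 ⊢ <;> omega

/-- Given transitions `k₁`, `k₂`, `k₃` in three consecutive loops, one of the corresponding
anchor points lies between two of these transitions. -/
lemma exists_anchor_between (hS : P.Uniform S h F) {p₀ p₁ p₂ p₃ : ℕ} (h₀ : p₀ ∈ S)
    (h₁ : p₁ ∈ S) (h₂ : p₂ ∈ S) (h₃ : p₃ ∈ S) (h01 : p₀ < p₁) (h12 : p₁ < p₂) (h23 : p₂ < p₃)
    (hN : ∀ p ∈ S, p ≤ N) {G : ℕ → Prop} (k : Fin 3 → ℕ) (hk : ∀ t, k t < P.len)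
    (hkG : ∀ t, G (k t))
    (hk0 : p₀ ≤ P.hd (k 0) ∧ P.hd (k 0) < p₁) (hk1 : p₁ ≤ P.hd (k 1) ∧ P.hd (k 1) < p₂)
    (hk2 : p₂ ≤ P.hd (k 2) ∧ P.hd (k 2) < p₃) :
    ∃ p ∈ S, ∃ q ∈ S, p < q ∧ ∃ i j l m M, P.Seg p q i j ∧ i ≤ l ∧ l < j ∧ G l ∧
      IsFlowCycle F m M ∧ m ≤ P.lv i ∧ P.lv i ≤ M ∧
      ∃ s t, P.anchorTime p q M ≤ k s ∧ k t < P.anchorTime p q M := by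
  have data : ∀ p ∈ S, ∀ q ∈ S, p < q → ∀ l < P.len, (p ≤ P.hd l ∧ P.hd l < q) →
      ∃ i j m M, P.Seg p q i j ∧ i ≤ l ∧ l < j ∧ IsFlowCycle F m M ∧ m ≤ P.lv i ∧
        P.lv i ≤ M := by
    intro p hp q hq hpq l hl hm
    obtain ⟨i, j, hs, h1, h2⟩ := exists_seg (hN q hq) hl hm
    have hedge : F (P.lv i) (P.lv j) := by
      rw [← hS.flow p hp q hq hpq]; exact ⟨i, j, hs, rfl, rfl⟩
    obtain ⟨m, M, hc, h3, h4⟩ := hS.idem.exists_cycle (hS.idem.lt_left hedge)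
    exact ⟨i, j, m, M, hs, h1, h2, hc, h3, h4⟩
  obtain ⟨i0, j0, m0, M0, s0, a0, b0, c0, d0, e0⟩ := data p₀ h₀ p₁ h₁ h01 _ (hk 0) hk0
  obtain ⟨i1, j1, m1, M1, s1, a1, b1, c1, d1, e1⟩ := data p₁ h₁ p₂ h₂ h12 _ (hk 1) hk1
  obtain ⟨i2, j2, m2, M2, s2, a2, b2, c2, d2, e2⟩ := data p₂ h₂ p₃ h₃ h23 _ (hk 2) hk2
  have r01 := hS.anchor_between h₀ h₁ h₁ h₂ h01 le_rfl h12 c0 s0 d0 e0 c1 s1 d1 e1 a0 b0 a1 b1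
  have r02 := hS.anchor_between h₀ h₁ h₂ h₃ h01 h12.le h23 c0 s0 d0 e0 c2 s2 d2 e2 a0 b0 a2 b2
  have r12 := hS.anchor_between h₁ h₂ h₂ h₃ h12 le_rfl h23 c1 s1 d1 e1 c2 s2 d2 e2 a1 b1 a2 b2
  have f0 := fun h => (⟨p₀, h₀, p₁, h₁, h01, i0, j0, _, m0, M0, s0, a0, b0, hkG 0, c0, d0, e0, h⟩ :
    ∃ p ∈ S, ∃ q ∈ S, p < q ∧ ∃ i j l m M, P.Seg p q i j ∧ i ≤ l ∧ l < j ∧ G l ∧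
      IsFlowCycle F m M ∧ m ≤ P.lv i ∧ P.lv i ≤ M ∧
      ∃ s t, P.anchorTime p q M ≤ k s ∧ k t < P.anchorTime p q M)
  have f1 := fun h => (⟨p₁, h₁, p₂, h₂, h12, i1, j1, _, m1, M1, s1, a1, b1, hkG 1, c1, d1, e1, h⟩ :
    ∃ p ∈ S, ∃ q ∈ S, p < q ∧ ∃ i j l m M, P.Seg p q i j ∧ i ≤ l ∧ l < j ∧ G l ∧
      IsFlowCycle F m M ∧ m ≤ P.lv i ∧ P.lv i ≤ M ∧
      ∃ s t, P.anchorTime p q M ≤ k s ∧ k t < P.anchorTime p q M)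
  have f2 := fun h => (⟨p₂, h₂, p₃, h₃, h23, i2, j2, _, m2, M2, s2, a2, b2, hkG 2, c2, d2, e2, h⟩ :
    ∃ p ∈ S, ∃ q ∈ S, p < q ∧ ∃ i j l m M, P.Seg p q i j ∧ i ≤ l ∧ l < j ∧ G l ∧
      IsFlowCycle F m M ∧ m ≤ P.lv i ∧ P.lv i ≤ M ∧
      ∃ s t, P.anchorTime p q M ≤ k s ∧ k t < P.anchorTime p q M)
  -- The eight orientations of the three pairs; each selects a loop with one loop before it and one
  -- after it.
  rcases r01 with r01 | r01 <;> rcases r02 with r02 | r02 <;> rcases r12 with r12 | r12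
  · exact f1 ⟨2, 0, r12.1, r01.2⟩
  · exact f2 ⟨1, 0, r12.1, r02.2⟩
  · exact f1 ⟨2, 0, r12.1, r01.2⟩
  · exact f0 ⟨1, 2, r01.1, r02.2⟩
  · exact f0 ⟨2, 1, r02.1, r01.2⟩
  · exact f0 ⟨2, 1, r02.1, r01.2⟩
  · exact f2 ⟨0, 1, r02.1, r12.2⟩
  · exact f1 ⟨0, 2, r01.1, r12.2⟩

end Uniform

end HeadPath

end TwoWay

namespace TwoWay

/-! ### Event words -/

/-- The edges of a flow, read off from the sequence of visits to the ends of an interval, where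
`true` stands for the left end. -/
def wordFlow {Q : Type*} (l : List (Bool × Q)) (y y' : ℕ) : Prop :=
  ∃ u e e' v, l = u ++ e :: e' :: v ∧ u.countP (fun f => f.1 == e.1) = y ∧
    (e.1 = true ↔ Even y) ∧ (u ++ [e]).countP (fun f => f.1 == e'.1) = y'

/-- The parity of `y` determines the end at which the edge starts, and the count `y` determines the
occurrence in the word. The target is the next letter. -/
lemma wordFlow.unique {Q : Type*} {l : List (Bool × Q)} {y y' y'' : ℕ} (h : wordFlow l y y')
    (h' : wordFlow l y y'') : y' = y'' := by
  obtain ⟨u, e, f, v, rfl, h1, h2, rfl⟩ := h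
  obtain ⟨u', e', f', v', h0, h1', h2', rfl⟩ := h'
  have hee : e.1 = e'.1 := by rw [Bool.eq_iff_iff, h2, h2']
  have key : ∀ {u u' : List (Bool × Q)} {e e' : Bool × Q} {as : List (Bool × Q)} {v v'}, e.1 = e'.1 →
      u' = u ++ as → e :: v = as ++ e' :: v' → u.countP (fun f => f.1 == e.1) = y →
      u'.countP (fun f => f.1 == e'.1) = y → as = [] := by
    intro u u' e e' as v v' hee hu hv h1 h2
    rcases as with _ | ⟨g, as⟩
    · rfl
    · simp only [List.cons_append, List.cons.injEq] at hv
      obtain ⟨rfl, -⟩ := hv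
      rw [hu, List.countP_append, ← hee, h1, List.countP_cons] at h2
      simp at h2
  have huu : u = u' := by
    rcases List.append_eq_append_iff.1 h0 with ⟨as, hu, hv⟩ | ⟨as, hu, hv⟩
    · rw [key hee hu hv h1 h1'] at hu; simpa using hu.symm
    · rw [key hee.symm hu hv h1' h1] at hu; simpa using hu
  subst huu
  have := List.append_cancel_left h0
  simp only [List.cons.injEq] at this
  obtain ⟨rfl, rfl, -⟩ := this
  rfl

/-- Left padding of words to length `n`. -/
def padLeft {α : Type*} (n : ℕ) (x : α) (l : List α) : List α := List.replicate (n - l.length) x ++ l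

lemma length_padLeft {α : Type*} {n : ℕ} {x : α} {l : List α} (h : l.length ≤ n) :
    (padLeft n x l).length = n := by
  simp [padLeft, h]

/-- Padding letters carry `false` and the words begin with `true`, so dropping the leading `false`
letters undoes the padding. -/
lemma padLeft_inj {Q : Type*} {n : ℕ} {q : Q} {l l' : List (Bool × Q)}
    (hl : ∃ e ∈ l.head?, e.1 = true) (hl' : ∃ e ∈ l'.head?, e.1 = true)
    (h : padLeft n (false, q) l = padLeft n (false, q) l') : l = l' := by
  have key : ∀ l : List (Bool × Q), (∃ e ∈ l.head?, e.1 = true) →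
      (padLeft n (false, q) l).dropWhile (fun e => !e.1) = l := by
    rintro (_ | ⟨e, l⟩) ⟨f, hf, h⟩
    · simp at hf
    · obtain rfl : e = f := by simpa using hf
      rw [padLeft, List.dropWhile_append_of_pos (by simp +contextual [List.mem_replicate])]
      simp [h]
  rw [← key l hl, ← key l' hl', h]

namespace HeadPath

variable {N : ℕ} (P : HeadPath N) {Q : Type*} (st : ℕ → Q)

/-- The states at the successive visits to position `x`. -/
def crossing (x : ℕ) : List Q :=
  ((List.range (P.len + 1)).filter fun i => P.ps i = x).map st

/-- The sequence of visits to the positions `a` and `b`. -/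
def events (a b : ℕ) : List (Bool × Q) :=
  ((List.range (P.len + 1)).filter fun i => P.ps i = a ∨ P.ps i = b).map
    fun i => (decide (P.ps i = a), st i)

variable {P st} {a b : ℕ}

lemma countP_range (p : ℕ → Prop) [DecidablePred p] (n : ℕ) :
    (List.range n).countP (fun i => p i) = Nat.count p n := by
  induction n with
  | zero => simp
  | succ n ih =>
    rw [List.range_succ, List.countP_append, ih, Nat.count_succ]
    simp [List.countP_cons]

lemma length_crossing (x : ℕ) : (P.crossing st x).length = P.height x := by
  rw [crossing, List.length_map, ← List.countP_eq_length_filter, countP_range]; rfl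

lemma crossing_left : P.crossing st a = ((P.events st a b).filter fun e => e.1).map Prod.snd := by
  rw [crossing, events, List.filter_map, List.map_map, List.filter_filter]
  congr 1
  apply List.filter_congr
  intro i _
  by_cases h : P.ps i = a <;> simp [h]

lemma crossing_right (hab : a ≠ b) :
    P.crossing st b = ((P.events st a b).filter fun e => !e.1).map Prod.snd := by
  rw [crossing, events, List.filter_map, List.map_map, List.filter_filter]
  congr 1
  apply List.filter_congr
  intro i _
  by_cases h : P.ps i = a
  · simp [h, hab]
  · simp [h]

lemma length_events (hab : a ≠ b) : (P.events st a b).length = P.height a + P.height b := by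
  rw [← length_crossing (st := st), ← length_crossing (st := st) b, crossing_left (b := b),
    crossing_right hab, List.length_map, List.length_map]
  exact List.length_eq_length_filter_add _

/-- The run starts at the left, so it visits `a` before `b`: at a visit to `b` the head is at a
place `≥ a`, and parity gives an earlier visit to `a`. -/
lemma events_head (hab : a < b) (hb : b ≤ N) : ∃ e ∈ (P.events st a b).head?, e.1 = true := by
  have hpos : (P.events st a b).length ≠ 0 := by
    have := P.height_odd hb
    rw [length_events hab.ne]; omega
  rw [events, List.length_map] at hpos
  obtain ⟨i, l, hl⟩ := List.exists_cons_of_length_pos (Nat.pos_of_ne_zero hpos)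
  rw [events, hl]
  refine ⟨(decide (P.ps i = a), st i), by simp, ?_⟩
  simp only [decide_eq_true_eq]
  obtain ⟨l₁, l₂, hr, h1, h2, -⟩ := List.filter_eq_cons_iff.1 hl
  by_contra hia
  have hib : P.ps i = b := by simpa [hia] using h2
  have hile : i ≤ P.len := by
    have : i ∈ List.range (P.len + 1) := by rw [hr]; simp
    rw [List.mem_range] at this; omega
  have hcnt := P.cnt_succ_odd a hile
  have hhd := P.ps_eq hile
  have hc : 0 < P.cnt a (i + 1) := by
    have := hcnt.2 (by omega)
    omega
  rw [cnt_succ, if_neg hia, add_zero, cnt, Nat.count_eq_card_filter_range, Finset.card_pos] at hc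
  obtain ⟨k, hk⟩ := hc
  rw [Finset.mem_filter, Finset.mem_range] at hk
  have hkr : k ∈ l₁ ++ i :: l₂ := by rw [← hr, List.mem_range]; omega
  have hsort : (l₁ ++ i :: l₂).Pairwise (· < ·) := by rw [← hr]; exact List.pairwise_lt_range
  rw [List.pairwise_append, List.pairwise_cons] at hsort
  simp only [List.mem_append, List.mem_cons] at hkr
  rcases hkr with hkr | rfl | hkr
  · exact h1 k hkr (by simp [hk.2])
  · omega
  · have := hsort.2.1.1 k hkr
    omega

lemma range_split {i j n : ℕ} (hij : i < j) (hj : j < n) :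
    List.range n = List.range i ++ i :: (List.range' (i + 1) (j - i - 1) ++
      j :: List.range' (j + 1) (n - j - 1)) := by
  obtain ⟨d, rfl⟩ := Nat.exists_eq_add_of_lt hij
  obtain ⟨r, rfl⟩ := Nat.exists_eq_add_of_lt hj
  have e1 : i + d + 1 - i - 1 = d := by omega
  have e2 : i + d + 1 + r + 1 - (i + d + 1) - 1 = r := by omega
  rw [e1, e2, ← List.range'_succ, show i + d + 1 = i + 1 + d by ring, List.range'_append_1,
    ← List.range'_succ, List.range_eq_range', List.range_eq_range']
  have := List.range'_append_1 (s := 0) (m := i) (n := d + (r + 1) + 1)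
  rw [zero_add] at this
  rw [this]
  congr 1; ring

lemma Seg.wordFlow {i j : ℕ} (hs : P.Seg a b i j) (hab : a < b) :
    wordFlow (P.events st a b) (P.lv i) (P.lv j) := by
  have hcount : ∀ k l, (P.ps l = a ∨ P.ps l = b) →
      ((((List.range k).filter fun i => P.ps i = a ∨ P.ps i = b).map
        fun i => (decide (P.ps i = a), st i)).countP
          fun f => f.1 == decide (P.ps l = a)) = P.cnt (P.ps l) k := by
    intro k l hl
    rw [List.countP_map, List.countP_filter, cnt, ← countP_range]
    congr 1
    ext i
    rcases hl with hl | hl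
    · by_cases h1 : P.ps i = a <;> simp [hl, h1]
    · have : P.ps l ≠ a := by omega
      by_cases h1 : P.ps i = a
      · simp [hl, h1, hab.ne, hab.ne']
      · by_cases h2 : P.ps i = b <;> simp [hl, h1, h2, hab.ne']
  have hsplit := range_split hs.lt (Nat.lt_succ_of_le hs.le)
  have hmid : (List.range' (i + 1) (j - i - 1)).filter (fun i => P.ps i = a ∨ P.ps i = b) = [] := by
    rw [List.filter_eq_nil_iff]
    intro k hk
    rw [List.mem_range'_1] at hk
    have := hs.ps_mid (k := k) (by omega) (by omega)
    simp only [decide_eq_true_eq]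
    omega
  refine ⟨((List.range i).filter fun i => P.ps i = a ∨ P.ps i = b).map
    fun i => (decide (P.ps i = a), st i), (decide (P.ps i = a), st i), (decide (P.ps j = a), st j),
    ((List.range' (j + 1) (P.len + 1 - j - 1)).filter fun i => P.ps i = a ∨ P.ps i = b).map
    fun i => (decide (P.ps i = a), st i), ?_, ?_, ?_, ?_⟩
  · rw [events, hsplit, List.filter_append, List.filter_cons_of_pos (by simpa using hs.ps_start),
      List.filter_append, hmid, List.filter_cons_of_pos (by simpa using hs.ps_end)]
    simp
  · exact hcount i i hs.ps_start
  · simp only [decide_eq_true_eq]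
    constructor
    · intro h
      by_contra hn
      have := hs.ps_start_odd (Nat.not_even_iff_odd.1 hn)
      omega
    · exact hs.ps_start_even
  · have := hcount (i + 1) j hs.ps_end
    rw [List.range_succ, List.filter_append,
      List.filter_cons_of_pos (by simpa using hs.ps_start), List.filter_nil, List.map_append,
      List.map_singleton] at this
    rw [this, ← hs.cnt_eq hs.ps_end]
    rfl

/-- The word of visits gives both heights, hence the sources of edges, and `wordFlow` gives their
targets. -/
lemma flow_eq_of_events_eq {a' b' : ℕ} (hab : a < b) (hb : b ≤ N) (hab' : a' < b') (hb' : b' ≤ N)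
    (h : P.events st a b = P.events st a' b') : P.flow a b = P.flow a' b' := by
  have key : ∀ {a b a' b'}, a < b → b ≤ N → a' < b' → b' ≤ N →
      P.events st a b = P.events st a' b' → ∀ y y', P.flow a b y y' → P.flow a' b' y y' := by
    rintro a b a' b' hab hb hab' hb' h y y' ⟨i, j, hs, rfl, rfl⟩
    have e1 : P.height a = P.height a' := by
      rw [← length_crossing (st := st), ← length_crossing (st := st), crossing_left (b := b), h,
        ← crossing_left]
    have e2 : P.height b = P.height b' := by
      rw [← length_crossing (st := st), ← length_crossing (st := st), crossing_right hab.ne, h,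
        ← crossing_right hab'.ne]
    have hlt := P.lv_lt_height (hs.lt.le.trans hs.le)
    have hy : Even (P.lv i) ∧ P.lv i < P.height a' ∨ Odd (P.lv i) ∧ P.lv i < P.height b' := by
      rcases Nat.even_or_odd (P.lv i) with hp | hp
      · rw [hs.ps_start_even hp, e1] at hlt; exact Or.inl ⟨hp, hlt⟩
      · rw [hs.ps_start_odd hp, e2] at hlt; exact Or.inr ⟨hp, hlt⟩
    obtain ⟨i', j', hs', hi'⟩ := exists_start_seg hab' hb' hy
    have w1 := hs.wordFlow (st := st) hab
    have w2 := hs'.wordFlow (st := st) hab'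
    rw [hi', ← h] at w2
    exact ⟨i', j', hs', hi', w2.unique w1⟩
  ext y y'
  exact ⟨key hab hb hab' hb' h y y', key hab' hb' hab hb h.symm y y'⟩

/-! ### Bounds for normalized runs, and the number of effects -/

variable (P st) in
/-- No two distinct configurations have the same position, the same state and levels of the same
parity. -/
def Normalized : Prop :=
  ∀ i ≤ P.len, ∀ j ≤ P.len, P.ps i = P.ps j → st i = st j →
    (Even (P.lv i) ↔ Even (P.lv j)) → i = j

/-- The states at the even levels are distinct, and as the height is odd there are `(height + 1) /
2` of them. -/
lemma Normalized.height_le [Fintype Q] (h : P.Normalized st) {x : ℕ} (hx : x ≤ N) :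
    P.height x ≤ 2 * Fintype.card Q - 1 := by
  have hodd := P.height_odd hx
  suffices (P.height x + 1) / 2 ≤ Fintype.card Q by omega
  rw [← Fintype.card_fin ((P.height x + 1) / 2)]
  refine Fintype.card_le_of_injective (fun t => st (P.time x (2 * t))) ?_
  intro t t' htt
  obtain ⟨h1, h2, h3⟩ := time_spec (P := P) (x := x) (y := 2 * t) (by have := t.2; omega)
  obtain ⟨h1', h2', h3'⟩ := time_spec (P := P) (x := x) (y := 2 * t') (by have := t'.2; omega)
  have := h _ h1 _ h1' (h2.trans h2'.symm) htt (by rw [h3, h3']; simp)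
  rw [this] at h3
  apply Fin.ext
  omega

/-- The place `s` serves position `s` at even levels and position `s + 1` at odd levels. Levels are
therefore distinct, and one height bound covers both positions. -/
lemma Normalized.card_hd_eq_le [Fintype Q] (h : P.Normalized st) (s : ℕ) :
    ((Finset.range P.len).filter fun k => P.hd k = s).card ≤ 2 * Fintype.card Q - 1 := by
  rw [← Finset.card_range (2 * Fintype.card Q - 1)]
  refine Finset.card_le_card_of_injOn P.lv ?_ ?_
  · intro k hk
    simp only [Finset.coe_filter, Finset.mem_range, Set.mem_ofPred_eq] at hk
    have h1 := P.hd_lt k hk.1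
    have h2 := P.ps_eq hk.1.le
    have h3 := P.lv_lt_height hk.1.le
    have := h.height_le (x := P.ps k) (by omega)
    simp only [Finset.coe_range, Set.mem_Iio]
    omega
  · intro k hk k' hk' hkk
    simp only [Finset.coe_filter, Finset.mem_range, Set.mem_ofPred_eq] at hk hk'
    refine P.loc_inj ?_ hkk
    rw [P.ps_eq hk.1.le, P.ps_eq hk'.1.le, hkk, hk.2, hk'.2]

lemma card_image_le_of_factors {α β γ : Type*} [DecidableEq β] [DecidableEq γ] (s : Finset α)
    (f : α → β) (g : α → γ) (h : ∀ x ∈ s, ∀ y ∈ s, g x = g y → f x = f y) :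
    (s.image f).card ≤ (s.image g).card := by
  classical
  have hch : ∀ v ∈ s.image f, ∃ x ∈ s, f x = v := fun v hv => Finset.mem_image.1 hv
  rcases s.eq_empty_or_nonempty with rfl | ⟨x₀, -⟩
  · simp
  have : Nonempty α := ⟨x₀⟩
  choose! c hc using hch
  refine Finset.card_le_card_of_injOn (fun v => g (c v)) ?_ ?_
  · intro v hv
    exact Finset.mem_image_of_mem g (hc v hv).1
  · intro v hv v' hv' hvv
    rw [← (hc v hv).2, ← (hc v' hv').2]
    exact h _ (hc v hv).1 _ (hc v' hv').1 hvv

variable (P st) in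
/-- The effect of `[a, b]` with bounded nodes. -/
def boundedEffect (H a b : ℕ) : BoundedEffect H {l : List Q // l.length ≤ H} where
  flow := ⟨fun y y' => P.flow a b y y' ∧ y < H ∧ y' < H, fun _ _ h => h.2⟩
  left := ⟨(P.crossing st a).take H, List.length_take_le _ _⟩
  right := ⟨(P.crossing st b).take H, List.length_take_le _ _⟩

/-- Sufficiently many positions contain four positions such that all intervals between them have
the same idempotent effect. -/
theorem exists_uniform [Fintype Q] (hn : P.Normalized st) (X : Finset ℕ) (hX : ∀ x ∈ X, x ≤ N)
    (hcard : 8 ^ ((2 * Fintype.card Q) ^ (2 * (2 * Fintype.card Q - 1))) < X.card) :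
    ∃ p₀ ∈ X, ∃ p₁ ∈ X, ∃ p₂ ∈ X, ∃ p₃ ∈ X, p₀ < p₁ ∧ p₁ < p₂ ∧ p₂ < p₃ ∧
      ∃ h F, P.Uniform {p₀, p₁, p₂, p₃} h F ∧
        ∀ p ∈ ({p₀, p₁, p₂, p₃} : Set ℕ), P.crossing st p = P.crossing st p₀ := by
  classical
  set H := 2 * Fintype.card Q - 1 with hH
  have hheight : ∀ x ≤ N, P.height x ≤ H := fun x hx => hn.height_le hx
  have hbd : ∀ a ≤ N, ∀ b ≤ N, ∀ y y', P.flow a b y y' → y < H ∧ y' < H := by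
    intro a ha b hb y y' h
    have h1 := flow_lt_left h
    have h2 := flow_lt_right h
    have h3 := hheight a ha
    have h4 := hheight b hb
    omega
  have hflow : ∀ a ≤ N, ∀ b ≤ N, (P.boundedEffect st H a b).flow.1 = P.flow a b := by
    intro a ha b hb
    ext y y'
    exact ⟨fun h => h.1, fun h => ⟨h, hbd a ha b hb y y' h⟩⟩
  have hcross : ∀ a ≤ N, (P.crossing st a).take H = P.crossing st a := fun a ha =>
    List.take_of_length_le (by rw [length_crossing]; exact hheight a ha)
  have hmul : ∀ a b c, a < b → b < c → c ≤ N →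
      P.boundedEffect st H a b * P.boundedEffect st H b c = P.boundedEffect st H a c := by
    intro a b c hab hbc hc
    refine BoundedEffect.ext (Subtype.ext ?_) rfl rfl
    rw [BoundedEffect.mul_def]
    simp only
    rw [hflow a (by omega) b (by omega), hflow b (by omega) c (by omega),
      hflow a (by omega) c (by omega), flow_eq_flowComp hab hbc]
  have : Finite {l : List Q // l.length ≤ H} := List.finite_length_le Q H
  let q : Q := st 0
  let pairs : Finset (ℕ × ℕ) := (X ×ˢ X).filter fun p => p.1 < p.2
  -- The unit is adjoined only because the Ramsey theorem is stated for monoids; no label equals it.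
  let E : ℕ → ℕ → WithOne (BoundedEffect H {l : List Q // l.length ≤ H}) :=
    fun a b => (P.boundedEffect st H a b : WithOne _)
  let V := pairs.image fun p => E p.1 p.2
  have hpairs : ∀ p ∈ pairs, p.1 < p.2 ∧ p.2 ≤ N := by
    intro p hp
    simp only [pairs, Finset.mem_filter, Finset.mem_product] at hp
    exact ⟨hp.2, hX _ hp.1.2⟩
  have hV : V.card ≤ (2 * Fintype.card Q) ^ (2 * H) := by
    have hlen : ∀ p ∈ pairs, (P.events st p.1 p.2).length ≤ 2 * H := by
      intro p hp
      obtain ⟨h1, h2⟩ := hpairs p hp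
      rw [length_events h1.ne]
      have := hheight p.1 (by omega)
      have := hheight p.2 h2
      omega
    -- Words of visits padded to length `2 * H` over an alphabet of `2 * |Q|` letters: this count is
    -- `emax`. The other branch of the definition never occurs on `pairs`.
    let code : ℕ × ℕ → List.Vector (Bool × Q) (2 * H) := fun p =>
      if h : (P.events st p.1 p.2).length ≤ 2 * H then
        ⟨padLeft (2 * H) (false, q) (P.events st p.1 p.2), length_padLeft h⟩
      else List.Vector.replicate _ (false, q)
    have hcode : ∀ p ∈ pairs,
        (code p).toList = padLeft (2 * H) (false, q) (P.events st p.1 p.2) := by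
      intro p hp
      exact congrArg List.Vector.toList (dif_pos (hlen p hp))
    calc V.card ≤ (pairs.image code).card := by
          refine card_image_le_of_factors _ _ _ fun x hx y hy hxy => ?_
          obtain ⟨x1, x2⟩ := hpairs x hx
          obtain ⟨y1, y2⟩ := hpairs y hy
          have hev := padLeft_inj (events_head x1 x2) (events_head y1 y2)
            ((hcode x hx).symm.trans ((congrArg _ hxy).trans (hcode y hy)))
          simp only [E, WithOne.coe_inj]
          refine BoundedEffect.ext (Subtype.ext ?_) (Subtype.ext ?_) (Subtype.ext ?_)
          · rw [hflow _ (by omega) _ (by omega), hflow _ (by omega) _ (by omega)]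
            exact flow_eq_of_events_eq x1 x2 y1 y2 hev
          · simp only [boundedEffect]
            rw [crossing_left (b := x.2), hev, ← crossing_left]
          · simp only [boundedEffect]
            rw [crossing_right x1.ne, hev, ← crossing_right y1.ne]
      _ ≤ Fintype.card (List.Vector (Bool × Q) (2 * H)) := Finset.card_le_univ _
      _ = _ := by rw [card_vector, Fintype.card_prod, Fintype.card_bool]
  have hE : Additive E X := by
    intro i hi j hj k hk hij hjk
    simp only [E]
    rw [← WithOne.coe_mul, hmul i j k hij hjk (hX k hk)]
  obtain ⟨i, hi, j, hj, k, hk, l, hl, hij, hjk, hkl, e1, e2, e3⟩ := hasTriple_of_card V X hE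
    (fun i hi j hj hij => Finset.mem_image.2 ⟨(i, j), by simp [pairs, hi, hj, hij], rfl⟩)
    ((Nat.pow_le_pow_right (by norm_num) hV).trans_lt hcard)
  simp only [E, ← WithOne.coe_mul, WithOne.coe_inj] at e1 e2 e3
  have hi' := hX i hi
  have hj' := hX j hj
  have hk' := hX k hk
  have hl' := hX l hl
  -- Idempotency extends the common label from the three consecutive intervals to all six intervals
  -- between the four positions.
  have e4 : P.boundedEffect st H i k = P.boundedEffect st H i j := by
    rw [← hmul i j k hij hjk hk', e1, e3]
  have e5 : P.boundedEffect st H j l = P.boundedEffect st H i j := by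
    rw [← hmul j k l hjk hkl hl', e1, e2, e3]
  have e6 : P.boundedEffect st H i l = P.boundedEffect st H i j := by
    rw [← hmul i j l hij (by omega) hl', e5, e3]
  have flow_of : ∀ a ≤ N, ∀ b ≤ N, P.boundedEffect st H a b = P.boundedEffect st H i j →
      P.flow a b = P.flow i j := by
    intro a ha b hb h
    rw [← hflow a ha b hb, h, hflow i hi' j hj']
  have cj : P.crossing st j = P.crossing st i := by
    have := congrArg (fun e => e.left.1) e1
    simp only [boundedEffect] at this
    rwa [hcross j hj', hcross i hi'] at this
  have ck : P.crossing st k = P.crossing st i := by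
    have := congrArg (fun e => e.left.1) e2
    simp only [boundedEffect] at this
    rwa [hcross k hk', hcross i hi'] at this
  have cl : P.crossing st l = P.crossing st i := by
    have := congrArg (fun e => e.right.1) e6
    simp only [boundedEffect] at this
    rwa [hcross l hl', hcross j hj', cj] at this
  have hc : ∀ p ∈ ({i, j, k, l} : Set ℕ), P.crossing st p = P.crossing st i := by
    rintro p (rfl | rfl | rfl | rfl)
    exacts [rfl, cj, ck, cl]
  have hh : ∀ p ∈ ({i, j, k, l} : Set ℕ), P.height p = P.height i := by
    intro p hp
    rw [← length_crossing (st := st), hc p hp, length_crossing]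
  refine ⟨i, hi, j, hj, k, hk, l, hl, hij, hjk, hkl, P.height i, P.flow i j, ⟨⟨?_, ?_, ?_⟩, hh, ?_⟩,
    hc⟩
  · have := isFlow (P := P) hij hj'
    rwa [hh j (by simp)] at this
  · have h1 := flow_eq_flowComp (P := P) hij hjk
    rw [flow_of i hi' k hk' e4, flow_of j hj' k hk' e1] at h1
    exact h1.symm
  · exact fun y y' => flow_succ
  · rintro p (rfl | rfl | rfl | rfl) r (rfl | rfl | rfl | rfl) hpr <;>
    first
    | omega
    | exact flow_of _ (by assumption) _ (by assumption) (by first | assumption | rfl)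

end HeadPath

end TwoWay

namespace TwoWay

namespace Run

variable {Q A Γ : Type*} {T : Transducer Q A Γ} {w : List A} (ρ : Run T w)

/-- The index of the configuration at time `i`. -/
def clamp (i : ℕ) : Fin (ρ.len + 1) := ⟨min i ρ.len, by omega⟩

lemma clamp_val (i : Fin (ρ.len + 1)) : ρ.clamp i = i := by
  ext; simp only [clamp]; omega

lemma clamp_mk {i : ℕ} (h : i < ρ.len + 1) : ρ.clamp i = ⟨i, h⟩ := ρ.clamp_val ⟨i, h⟩

lemma clamp_castSucc (k : Fin ρ.len) : ρ.clamp k = k.castSucc := ρ.clamp_val k.castSucc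

lemma clamp_succ (k : Fin ρ.len) : ρ.clamp (k + 1) = k.succ := ρ.clamp_val k.succ

lemma head_lt (k : Fin ρ.len) : ρ.head k.castSucc < w.length :=
  (List.getElem?_eq_some_iff.1 (ρ.trans_letter k)).1

lemma step (k : Fin ρ.len) :
    (ρ.head k.succ = ρ.head k.castSucc + 1 ∧ ρ.pos k.succ = ρ.head k.castSucc + 1) ∨
    (ρ.head k.succ + 1 = ρ.head k.castSucc ∧ ρ.pos k.succ = ρ.head k.castSucc) := by
  rcases hd : (ρ.trans k).dir with _ | _
  · have := ρ.move_left k hd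
    exact Or.inr ⟨this, by simp [pos, hd, this]⟩
  · have := ρ.move_right k hd
    exact Or.inl ⟨this, by simp [pos, hd, this]⟩

/-- The trajectory of the head in a successful run. -/
def headPath (hρ : ρ.Successful) : HeadPath w.length where
  len := ρ.len
  hd i := ρ.head (ρ.clamp i)
  ps i := ρ.pos (ρ.clamp i)
  hd_zero := by rw [ρ.clamp_mk (Nat.succ_pos _)]; exact hρ.2.1
  ps_zero := by rw [ρ.clamp_mk (Nat.succ_pos _)]; exact hρ.2.1
  step k hk := by
    have := ρ.step ⟨k, hk⟩
    rwa [← clamp_castSucc, ← clamp_succ] at this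
  hd_lt k hk := by
    have := ρ.head_lt ⟨k, hk⟩
    rwa [← clamp_castSucc] at this
  hd_len := by rw [ρ.clamp_mk (Nat.lt_succ_self _)]; exact hρ.2.2.2

/-- The state at time `i`. -/
def stateAt (i : ℕ) : Q := ρ.state (ρ.clamp i)

variable {ρ} (hρ : ρ.Successful)

lemma headPath_len : (ρ.headPath hρ).len = ρ.len := rfl

lemma headPath_hd (i : Fin (ρ.len + 1)) : (ρ.headPath hρ).hd i = ρ.head i :=
  congrArg ρ.head (ρ.clamp_val i)

lemma headPath_ps (i : Fin (ρ.len + 1)) : (ρ.headPath hρ).ps i = ρ.pos i :=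
  congrArg ρ.pos (ρ.clamp_val i)

lemma headPath_lv (i : Fin (ρ.len + 1)) : (ρ.headPath hρ).lv i = ρ.level i := by
  rw [HeadPath.lv, HeadPath.cnt, Nat.count_eq_card_filter_range, level]
  symm
  refine Finset.card_bij (fun j _ => (j : ℕ)) ?_ ?_ ?_
  · intro j hj
    simp only [Finset.mem_filter, Finset.mem_univ, true_and] at hj
    rw [Finset.mem_filter, Finset.mem_range, headPath_ps, headPath_ps]
    exact hj
  · intro j _ j' _ h
    exact Fin.ext h
  · intro j hj
    rw [Finset.mem_filter, Finset.mem_range] at hj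
    have hlt : j < ρ.len + 1 := hj.1.trans i.2
    refine ⟨⟨j, hlt⟩, ?_, rfl⟩
    simp only [Finset.mem_filter, Finset.mem_univ, true_and]
    refine ⟨hj.1, ?_⟩
    rw [← headPath_ps hρ, ← headPath_ps hρ]
    exact hj.2

lemma loc_eq (i : Fin (ρ.len + 1)) :
    ρ.loc i = ((ρ.headPath hρ).ps i, (ρ.headPath hρ).lv i) := by
  rw [headPath_ps, headPath_lv]; rfl

lemma loc_injective (hρ : ρ.Successful) {i j : Fin (ρ.len + 1)} (h : ρ.loc i = ρ.loc j) : i = j := by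
  rw [loc_eq hρ, loc_eq hρ, Prod.mk.injEq] at h
  exact Fin.ext ((ρ.headPath hρ).loc_inj h.1 h.2)

lemma crossing_eq (x : ℕ) : ρ.crossing x = (ρ.headPath hρ).crossing ρ.stateAt x := by
  rw [HeadPath.crossing, headPath_len, ← List.map_coe_finRange_eq_range, List.filter_map,
    List.map_map, crossing]
  have h1 : ρ.stateAt ∘ (Fin.val : Fin (ρ.len + 1) → ℕ) = ρ.state :=
    funext fun i => congrArg ρ.state (ρ.clamp_val i)
  rw [h1]
  congr 1
  apply List.filter_congr
  intro i _
  simp only [Function.comp, headPath_ps]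

lemma length_crossing (x : ℕ) : (ρ.crossing x).length = (ρ.headPath hρ).height x := by
  rw [crossing_eq hρ, HeadPath.length_crossing]

lemma Normalized.headPath (hn : ρ.Normalized) : (ρ.headPath hρ).Normalized ρ.stateAt := by
  intro i hi j hj h1 h2 h3
  rw [headPath_len] at hi hj
  have h := hn ⟨i, by omega⟩ ⟨j, by omega⟩
  rw [← headPath_ps hρ, ← headPath_ps hρ, ← headPath_lv hρ, ← headPath_lv hρ] at h
  simp only [stateAt] at h2
  rw [ρ.clamp_mk (by omega), ρ.clamp_mk (by omega)] at h2
  exact congrArg Fin.val (h h1 h2 h3)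

/-! ### Intercepted factors -/

lemma staysIn_iff {x₁ x₂ : ℕ} {i j : Fin (ρ.len + 1)} : ρ.StaysIn x₁ x₂ i j ↔ i ≤ j ∧
    (∀ m : ℕ, i ≤ m → m ≤ j → x₁ ≤ (ρ.headPath hρ).ps m ∧ (ρ.headPath hρ).ps m ≤ x₂) ∧
    ∀ k : ℕ, i ≤ k → k < j → x₁ ≤ (ρ.headPath hρ).hd k ∧ (ρ.headPath hρ).hd k < x₂ := by
  refine and_congr Iff.rfl (and_congr ⟨fun h m h1 h2 => ?_, fun h m h1 h2 => ?_⟩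
    ⟨fun h k h1 h2 => ?_, fun h k h1 h2 => ?_⟩)
  · have := h ⟨m, h2.trans_lt j.2⟩ h1 h2
    rwa [← headPath_ps hρ] at this
  · have := h m h1 h2
    rwa [headPath_ps] at this
  · have hk : k < ρ.len := by have := j.2; omega
    have := h ⟨k, hk⟩ h1 h2
    rwa [← headPath_hd hρ] at this
  · have := h k h1 (show (k : ℕ) + 1 ≤ j from h2)
    rw [← headPath_hd hρ]
    exact this

/-- Maximality means that neither neighbouring transition reads a letter of the interval. A factor
of length zero is never maximal, because at each visit to a position of the interval an adjacent
transition does read such a letter. -/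
lemma intercepted_iff {x₁ x₂ : ℕ} (hx : x₁ < x₂) (hx₂ : x₂ ≤ w.length) {i j : Fin (ρ.len + 1)} :
    ρ.Intercepted x₁ x₂ (i, j) ↔ (ρ.headPath hρ).Seg x₁ x₂ i j := by
  set P := ρ.headPath hρ with hP
  have hlen : P.len = ρ.len := rfl
  have hj := j.2
  constructor
  · rintro ⟨hs, hmax⟩
    simp only [staysIn_iff hρ, ← hP] at hs hmax
    obtain ⟨hij, hpos, hmem⟩ := hs
    have hij' : (i : ℕ) ≤ j := hij
    have hexit : ¬ (x₁ ≤ P.hd j ∧ P.hd j < x₂) := by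
      intro h
      have hjl : (j : ℕ) < P.len := by
        by_contra hn
        have : (j : ℕ) = P.len := by omega
        rw [this, P.hd_len] at h
        omega
      have h1 := hmax i ⟨j + 1, by omega⟩ le_rfl (by rw [Fin.le_def]; simp) ⟨?_, ?_, ?_⟩
      · have := congrArg Fin.val h1.2
        simp at this
      · rw [Fin.le_def]; simp only; omega
      · intro m h1 h2
        simp only at h2
        rcases h2.eq_or_lt with rfl | h2
        · have := P.step j hjl
          omega
        · exact hpos m h1 (by omega)
      · intro m h1 h2
        simp only at h2
        rcases (Nat.lt_succ_iff.1 h2).eq_or_lt with rfl | h2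
        · exact h
        · exact hmem m h1 h2
    have hentry : ∀ k, k + 1 = (i : ℕ) → ¬ (x₁ ≤ P.hd k ∧ P.hd k < x₂) := by
      intro k hk h
      have h1 := hmax ⟨k, by omega⟩ j (by rw [Fin.le_def]; simp only; omega) le_rfl ⟨?_, ?_, ?_⟩
      · have := congrArg Fin.val h1.1
        simp only at this
        omega
      · rw [Fin.le_def]; simp only; omega
      · intro m h1 h2
        simp only at h1
        rcases h1.eq_or_lt with rfl | h1
        · have := P.ps_eq (i := k) (by omega)
          omega
        · exact hpos m (by omega) h2
      · intro m h1 h2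
        simp only at h1
        rcases h1.eq_or_lt with rfl | h1
        · exact h
        · exact hmem m (by omega) h2
    have hne : (i : ℕ) ≠ j := by
      intro hij
      have hp := hpos j (by omega) le_rfl
      have he := P.ps_eq (i := j) (by omega)
      rw [hij] at hentry
      rcases hj0 : (j : ℕ) with _ | k
      · rw [hj0] at hp hexit
        have := P.hd_zero
        have := P.ps_zero
        omega
      · have h1 := hentry k hj0.symm
        have h2 := P.step k (by omega)
        rw [hj0] at hp hexit
        omega
    exact ⟨by omega, by omega, hmem, hentry, hexit⟩
  · intro hs
    have hlt := hs.lt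
    have hps := hs.ps_start
    have hpe := hs.ps_end
    refine ⟨(staysIn_iff hρ).2 ⟨hlt.le, ?_, hs.mem⟩, ?_⟩
    · intro m h1 h2
      rw [← hP]
      simp only at h1 h2
      rcases h1.eq_or_lt with rfl | h1
      · omega
      rcases h2.eq_or_lt with rfl | h2
      · omega
      have := hs.ps_mid h1 h2
      omega
    · intro i' j' hi' hj' hs'
      obtain ⟨-, -, hmem⟩ := (staysIn_iff hρ).1 hs'
      simp only [Fin.le_def] at hi' hj'
      constructor
      · by_contra hne
        have hne : (i' : ℕ) ≠ i := fun h => hne (Fin.ext h)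
        exact hs.entry (i - 1) (by omega) (hmem _ (by omega) (by omega))
      · by_contra hne
        have hne : (j' : ℕ) ≠ j := fun h => hne (Fin.ext h)
        exact hs.exit (hmem j (by omega) (by omega))

lemma flow_eq {x₁ x₂ : ℕ} (hx : x₁ < x₂) (hx₂ : x₂ ≤ w.length) :
    ρ.flow x₁ x₂ = (ρ.headPath hρ).flow x₁ x₂ := by
  ext y y'
  constructor
  · rintro ⟨⟨i, j⟩, hβ, h1, h2⟩
    refine ⟨i, j, (intercepted_iff hρ hx hx₂).1 hβ, ?_, ?_⟩
    · simp only [loc_eq hρ, Prod.mk.injEq] at h1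
      tauto
    · simp only [loc_eq hρ, Prod.mk.injEq] at h2
      tauto
  · rintro ⟨i, j, hs, rfl, rfl⟩
    have hlt := hs.lt
    have hle : j ≤ ρ.len := hs.le
    refine ⟨(⟨i, by omega⟩, ⟨j, by omega⟩), (intercepted_iff hρ hx hx₂).2 hs, ?_, ?_⟩
    · simp only [loc_eq hρ, Prod.mk.injEq, and_true]
      exact hs.ps_start
    · simp only [loc_eq hρ, Prod.mk.injEq, and_true]
      exact hs.ps_end

/-! ### Components and traces -/

/-- The cycle connects all of its nodes, and as outgoing edges are unique no path leaves it. -/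
lemma isComponent_Icc {x₁ x₂ m M h : ℕ} (hF : IsIdempotentFlow h (ρ.flow x₁ x₂))
    (hc : IsFlowCycle (ρ.flow x₁ x₂) m M)
    (hh : h ≤ max (ρ.crossing x₁).length (ρ.crossing x₂).length) :
    ρ.IsComponent x₁ x₂ (Set.Icc m M) := by
  have hup : ∀ v, m ≤ v → v ≤ M → Relation.ReflTransGen (ρ.flow x₁ x₂) m v := by
    intro v h1
    induction v, h1 using Nat.le_induction with
    | base => exact fun _ => .refl
    | succ v h1 ih => exact fun h2 => (ih (by omega)).tail (hc.succ v h1 h2)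
  have hdown : ∀ d v, v + d = M → m ≤ v → Relation.ReflTransGen (ρ.flow x₁ x₂) v m := by
    intro d
    induction d with
    | zero =>
      rintro v rfl -
      exact .single hc.through
    | succ d ih =>
      intro v h1 h2
      exact .head (hc.succ v h2 (by omega)) (ih (v + 1) (by omega) (by omega))
  have hin : ∀ v, Relation.ReflTransGen (ρ.flow x₁ x₂) m v → m ≤ v ∧ v ≤ M := by
    intro v hv
    induction hv with
    | refl => exact ⟨le_rfl, hc.le⟩
    | tail _ hbc ih =>
      rcases ih.2.eq_or_lt with rfl | hlt
      · rw [hF.isFlow.out_unique _ _ _ hbc hc.through]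
        exact ⟨le_rfl, hc.le⟩
      · rw [hF.isFlow.out_unique _ _ _ hbc (hc.succ _ ih.1 hlt)]
        exact ⟨by omega, hlt⟩
  refine ⟨m, (hc.le.trans_lt (hF.lt_left hc.through)).trans_le hh, ?_⟩
  ext v
  simp only [Set.mem_Icc, Set.mem_ofPred_eq]
  constructor
  · rintro ⟨h1, h2⟩
    exact ⟨hup v h1 h2, hdown (M - v) v (by omega) h1⟩
  · exact fun h => hin v h.1

/-- The trace of the cycle `m, …, M`, and a factor that occurs in it. -/
lemma exists_trace {x₁ x₂ m M : ℕ}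
    (hc : IsFlowCycle (ρ.flow x₁ x₂) m M) (β₀ : Fin (ρ.len + 1) × Fin (ρ.len + 1))
    (hβ₀ : ∀ β, ρ.Intercepted x₁ x₂ β → ρ.level β.1 = ρ.level β₀.1 → β = β₀)
    (hm : m ≤ ρ.level β₀.1) (hM : ρ.level β₀.1 ≤ M) :
    ∃ τ, ρ.IsTrace x₁ x₂ (Set.Icc m M) τ ∧ β₀ ∈ τ := by
  have hedge : ∀ v, ∃ β, m ≤ v → v ≤ M → ρ.Intercepted x₁ x₂ β ∧ ρ.level β.1 = v ∧
      ρ.level β.2 = if v = M then m else v + 1 := by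
    intro v
    by_cases hv : m ≤ v ∧ v ≤ M
    · have he : ρ.flow x₁ x₂ v (if v = M then m else v + 1) := by
        split_ifs with hvM
        · rw [hvM]; exact hc.through
        · exact hc.succ v hv.1 (by omega)
      obtain ⟨β, hβ, h1, h2⟩ := he
      refine ⟨β, fun _ _ => ⟨hβ, ?_, ?_⟩⟩
      · simp only [loc, Prod.mk.injEq] at h1; tauto
      · simp only [loc, Prod.mk.injEq] at h2; tauto
    · exact ⟨β₀, fun h1 h2 => absurd ⟨h1, h2⟩ hv⟩
  choose β hβ using hedge
  have hle := hc.le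
  -- The sources of the successive factors: `M, m, m + 1, …, M - 1`. The last factor ends at level
  -- `M` again.
  set nodes := M :: List.range' m (M - m) with hnodes
  have hmem : ∀ v, v ∈ nodes ↔ m ≤ v ∧ v ≤ M := by
    intro v
    rw [hnodes, List.mem_cons, List.mem_range'_1]
    omega
  have hlevel : nodes.map (fun v => ρ.level (β v).1) = nodes := by
    conv_rhs => rw [← List.map_id nodes]
    refine List.map_congr_left fun v hv => ?_
    obtain ⟨h1, h2⟩ := (hmem v).1 hv
    exact (hβ v h1 h2).2.1
  refine ⟨nodes.map β, ⟨by simp [hnodes], ?_, ?_, ?_, ?_, ?_⟩, ?_⟩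
  · intro b hb
    obtain ⟨v, hv, rfl⟩ := List.mem_map.1 hb
    obtain ⟨h1, h2⟩ := (hmem v).1 hv
    exact (hβ v h1 h2).1
  · intro b hb
    obtain rfl : β M = b := by simpa [hnodes] using hb
    rw [(hβ M hle le_rfl).2.1]
    exact isGreatest_Icc hle
  · intro b hb
    suffices hs : ∃ v, m ≤ v ∧ v ≤ M ∧ β v = b ∧ (if v = M then m else v + 1) = M by
      obtain ⟨v, h1, h2, rfl, h3⟩ := hs
      rw [(hβ v h1 h2).2.2, h3]
      exact isGreatest_Icc hle
    rcases hd : M - m with _ | d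
    · rw [hnodes, hd] at hb
      exact ⟨M, hle, le_rfl, by simpa using hb, by rw [if_pos rfl]; omega⟩
    · rw [hnodes, hd, List.range'_concat, ← List.cons_append, List.map_append, List.map_singleton,
        List.getLast?_concat] at hb
      refine ⟨m + d, by omega, by omega, by simpa using hb, ?_⟩
      rw [if_neg (by omega)]; omega
  · rw [List.isChain_map, List.isChain_iff_getElem]
    intro i hi
    have hlen : nodes.length = M - m + 1 := by simp [hnodes]
    have h1 := (hmem _).1 (List.getElem_mem (l := nodes) (n := i) (by omega))
    have h2 := (hmem _).1 (List.getElem_mem (l := nodes) (n := i + 1) hi)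
    rw [(hβ _ h1.1 h1.2).2.2, (hβ _ h2.1 h2.2).2.1]
    rcases i with _ | i
    · simp [hnodes]
    · simp only [hnodes, List.getElem_cons_succ, List.getElem_range']
      rw [if_neg (by omega)]; ring
  · rw [List.map_map]
    change (nodes.map fun v => ρ.level (β v).1).Nodup
    rw [hlevel, hnodes, List.nodup_cons, List.mem_range'_1]
    exact ⟨by omega, List.nodup_range'⟩
  · refine List.mem_map.2 ⟨ρ.level β₀.1, (hmem _).2 ⟨hm, hM⟩, ?_⟩
    exact hβ₀ _ (hβ _ hm hM).1 (hβ _ hm hM).2.1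

lemma outFactor_ne_nil {β : Fin (ρ.len + 1) × Fin (ρ.len + 1)} {k : Fin ρ.len}
    (h1 : β.1 ≤ k.castSucc) (h2 : k.succ ≤ β.2) (hk : (ρ.trans k).out ≠ []) :
    ρ.outFactor β ≠ [] := by
  intro h
  rw [outFactor, outOn, List.flatMap_eq_nil_iff] at h
  exact hk (h k (by simp [h1, h2]))

open Classical in
/-- The transitions in `S` with nonempty output, seen as a finite set. -/
noncomputable def productive (ρ : Run T w) (S : Set (Fin ρ.len)) : Finset (Fin ρ.len) :=
  Finset.univ.filter fun k => k ∈ S ∧ (ρ.trans k).out ≠ []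

lemma length_outOn_le (S : Set (Fin ρ.len)) :
    (ρ.outOn S).length ≤ T.capacity * (ρ.productive S).card := by
  classical
  have hcap : ∀ k, (ρ.trans k).out.length ≤ T.capacity := fun k =>
    Finset.le_sup (f := fun t : Transition Q A Γ => t.out.length) (ρ.trans_mem k)
  rw [outOn, List.length_flatMap]
  have h1 : (((List.finRange ρ.len).filter fun k => k ∈ S).map fun k => (ρ.trans k).out.length).sum
      = ∑ k ∈ Finset.univ.filter (fun k => k ∈ S), (ρ.trans k).out.length := by
    rw [← List.sum_toFinset _ ((List.nodup_finRange _).filter _)]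
    refine Finset.sum_congr ?_ fun _ _ => rfl
    ext k
    simp
  rw [h1, mul_comm, ← smul_eq_mul, ← Finset.sum_const]
  have hsub : ρ.productive S ⊆ Finset.univ.filter fun k => k ∈ S := by
    intro k hk
    simp only [productive, Finset.mem_filter, Finset.mem_univ, true_and] at hk ⊢
    exact hk.1
  rw [← Finset.sum_subset hsub]
  · exact Finset.sum_le_sum fun k _ => hcap k
  · intro k hk hk'
    simp only [productive, Finset.mem_filter, Finset.mem_univ, true_and] at hk hk'
    have : (ρ.trans k).out = [] := by
      by_contra hne
      exact hk' ⟨hk, hne⟩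
    rw [this]; rfl

/-- There are at most `hmax` transitions at each place of the head. -/
lemma card_productive_le [Fintype Q] (hρ : ρ.Successful) (hn : ρ.Normalized)
    (S : Set (Fin ρ.len)) :
    (ρ.productive S).card ≤
      T.hmax * ((ρ.productive S).image fun k => ρ.head k.castSucc).card := by
  classical
  refine Finset.card_le_mul_card_image _ _ fun s _ => ?_
  refine le_trans ?_ ((hn.headPath hρ).card_hd_eq_le s)
  refine Finset.card_le_card_of_injOn (fun k => (k : ℕ)) ?_ fun k _ k' _ h => Fin.ext h
  intro k hk
  simp only [Finset.coe_filter, Set.mem_ofPred_eq, Finset.mem_range] at hk ⊢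
  refine ⟨k.2, ?_⟩
  rw [← hk.2]
  exact headPath_hd hρ k.castSucc

end Run

end TwoWay

/-! ### From productive places to the loop, its anchor point and its trace -/

namespace TwoWay

namespace Run

variable {Q A Γ : Type*} {T : Transducer Q A Γ} {w : List A} {ρ : Run T w}

lemma time_bounds_of_mem (hρ : ρ.Successful) {ℓ₁ ℓ₂ : ℕ × ℕ} {i₁ i₂ : Fin (ρ.len + 1)}
    (h₁ : ρ.loc i₁ = ℓ₁) (h₂ : ρ.loc i₂ = ℓ₂) {i : Fin (ρ.len + 1)}
    (hi : ρ.loc i ∈ ρ.locInterval ℓ₁ ℓ₂) : i₁ ≤ i ∧ i ≤ i₂ := by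
  obtain ⟨⟨a, b, hab, ha, hb⟩, ⟨c, d, hcd, hc, hd⟩⟩ := hi
  rw [loc_injective hρ (h₁.trans ha.symm), loc_injective hρ (h₂.trans hd.symm)]
  rw [loc_injective hρ hb] at hab
  rw [loc_injective hρ hc] at hcd
  exact ⟨hab, hcd⟩

lemma isIdempotentLoop_of_uniform (hρ : ρ.Successful) {S : Set ℕ} {h : ℕ} {F : ℕ → ℕ → Prop}
    (hS : (ρ.headPath hρ).Uniform S h F) {a b : ℕ} (ha : a ∈ S) (hb : b ∈ S) (hab : a < b)
    (hbw : b ≤ w.length) (hcr : ρ.crossing a = ρ.crossing b) : ρ.IsIdempotentLoop a b := by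
  have hflow : ρ.flow a b = F := by rw [flow_eq hρ hab hbw, hS.flow a ha b hb hab]
  refine ⟨⟨⟨hab, hbw⟩, hcr⟩, ?_, by simp [effect]⟩
  rw [effect, effectMul, hflow, hS.idem.idem, if_pos]
  refine ⟨hcr.symm, ?_⟩
  rw [length_crossing hρ, length_crossing hρ, hS.height a ha, hS.height b hb]
  exact hS.idem.isFlow

/-- Among many productive transitions inside an interval there are three, at consecutive
idempotent loops, and one of the corresponding anchor points is between two of them. -/
lemma exists_loop_of_card [Fintype Q] (hρ : ρ.Successful) (hn : ρ.Normalized)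
    (S : Set (Fin ρ.len)) (X : Finset ℕ)
    (hX : ∀ x ∈ X, ∃ k ∈ S, (ρ.trans k).out ≠ [] ∧ ρ.head k.castSucc = x)
    (hcard : 2 ^ (3 * T.emax) < X.card) :
    ∃ a ∈ X, ∃ b ∈ X, a < b ∧ ρ.IsIdempotentLoop a b ∧ ∃ C i, ρ.IsComponent a b C ∧
      ρ.IsAnchor a b C (ρ.loc i) ∧ (∃ k ∈ S, i ≤ k.castSucc) ∧ (∃ k ∈ S, k.succ ≤ i) ∧
      ∃ τ, ρ.IsTrace a b C τ ∧ ρ.outTrace τ ≠ [] := by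
  set P := ρ.headPath hρ with hP
  have hXw : ∀ x ∈ X, x ≤ w.length := by
    intro x hx
    obtain ⟨k, -, -, rfl⟩ := hX x hx
    exact ρ.head_le _
  obtain ⟨p₀, hp₀, p₁, hp₁, p₂, hp₂, p₃, hp₃, h01, h12, h23, h, F, hU, hcr⟩ :=
    HeadPath.exists_uniform (hn.headPath hρ) X hXw (by
      have : (8 : ℕ) = 2 ^ 3 := by norm_num
      rw [this, ← pow_mul]
      exact hcard)
  obtain ⟨k₀, hk₀S, hk₀o, hk₀⟩ := hX p₀ hp₀
  obtain ⟨k₁, hk₁S, hk₁o, hk₁⟩ := hX p₁ hp₁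
  obtain ⟨k₂, hk₂S, hk₂o, hk₂⟩ := hX p₂ hp₂
  have hsub : ∀ p ∈ ({p₀, p₁, p₂, p₃} : Set ℕ), p ∈ X := by
    rintro p (rfl | rfl | rfl | rfl) <;> assumption
  have hd : ∀ k : Fin ρ.len, P.hd k = ρ.head k.castSucc := fun k => headPath_hd hρ k.castSucc
  let K : Fin 3 → Fin ρ.len := ![k₀, k₁, k₂]
  have hKS : ∀ t, K t ∈ S ∧ (ρ.trans (K t)).out ≠ [] := by
    intro t
    fin_cases t
    exacts [⟨hk₀S, hk₀o⟩, ⟨hk₁S, hk₁o⟩, ⟨hk₂S, hk₂o⟩]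
  -- The transition read at place `pᵢ` reads the letter just to the right of position `pᵢ`, so it
  -- belongs to the loop `[pᵢ, pᵢ₊₁]`. The predicate `G` keeps track of its productivity.
  obtain ⟨a, ha, b, hb, hab, i, j, l, m, M, hs, hil, hlj, ⟨k, hkl, hko⟩, hc, hm, hM, s, t, h1, h2⟩ :=
    hU.exists_anchor_between (p₀ := p₀) (p₁ := p₁) (p₂ := p₂) (p₃ := p₃) (by simp) (by simp)
      (by simp) (by simp) h01 h12 h23 (fun p hp => hXw p (hsub p hp))
      (G := fun l => ∃ k : Fin ρ.len, (k : ℕ) = l ∧ (ρ.trans k).out ≠ [])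
      (fun t => (K t : ℕ)) (fun t => (K t).2) (fun t => ⟨K t, rfl, (hKS t).2⟩)
      (by rw [hd]; change p₀ ≤ ρ.head k₀.castSucc ∧ ρ.head k₀.castSucc < p₁; omega)
      (by rw [hd]; change p₁ ≤ ρ.head k₁.castSucc ∧ ρ.head k₁.castSucc < p₂; omega)
      (by rw [hd]; change p₂ ≤ ρ.head k₂.castSucc ∧ ρ.head k₂.castSucc < p₃; omega)
  subst hkl
  have haX := hsub a ha
  have hbX := hsub b hb
  have hbw := hXw b hbX
  have hflow : ρ.flow a b = F := by rw [flow_eq hρ hab hbw, hU.flow a ha b hb hab]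
  have hle : j ≤ ρ.len := hs.le
  have hlt := hs.lt
  have hMh := hU.idem.lt_left hc.through
  have hcross : ρ.crossing a = ρ.crossing b := by
    rw [crossing_eq hρ, crossing_eq hρ, hcr a ha, hcr b hb]
  have htime : ∃ x, (x = if M % 2 = 0 then a else b) ∧ P.time x M = P.anchorTime a b M ∧
      M < P.height x := by
    rw [HeadPath.anchorTime]
    split_ifs
    · exact ⟨a, rfl, rfl, by rw [hU.height a ha]; exact hMh⟩
    · exact ⟨b, rfl, rfl, by rw [hU.height b hb]; exact hMh⟩
  obtain ⟨x, hx, hxt, hMx⟩ := htime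
  obtain ⟨ht1, ht2, ht3⟩ := HeadPath.time_spec (P := P) hMx
  rw [hxt] at ht1 ht2 ht3
  have ht1' : P.anchorTime a b M < ρ.len + 1 := Nat.lt_succ_of_le ht1
  have hloc : ρ.loc ⟨P.anchorTime a b M, ht1'⟩ = (x, M) := by
    rw [loc_eq hρ, Prod.mk.injEq]
    exact ⟨ht2, ht3⟩
  let β₀ : Fin (ρ.len + 1) × Fin (ρ.len + 1) := (⟨i, by omega⟩, ⟨j, by omega⟩)
  have hlvi : ρ.level β₀.1 = P.lv i := (headPath_lv hρ β₀.1).symm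
  obtain ⟨τ, hτ, hβτ⟩ := exists_trace (ρ := ρ) (x₁ := a) (x₂ := b) (m := m) (M := M)
    (by rw [hflow]; exact hc) β₀
    (by
      rintro ⟨i', j'⟩ hβ hlev
      have hs' := (intercepted_iff hρ hab hbw).1 hβ
      rw [← headPath_lv hρ, ← headPath_lv hρ] at hlev
      obtain ⟨e1, e2⟩ := hs'.eq_of_lv_start hs hlev
      exact Prod.ext (Fin.ext e1) (Fin.ext e2))
    (by rw [hlvi]; exact hm) (by rw [hlvi]; exact hM)
  refine ⟨a, haX, b, hbX, hab, isIdempotentLoop_of_uniform hρ hU ha hb hab hbw hcross,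
    Set.Icc m M, ⟨_, ht1'⟩, ?_, ?_, ⟨K s, (hKS s).1, h1⟩, ⟨K t, (hKS t).1, h2⟩, τ, hτ, ?_⟩
  · refine isComponent_Icc (h := h) (by rw [hflow]; exact hU.idem) (by rw [hflow]; exact hc) ?_
    rw [length_crossing hρ, length_crossing hρ, hU.height a ha, hU.height b hb, max_self]
  · refine ⟨m, M, isLeast_Icc hc.le, isGreatest_Icc hc.le, ?_⟩
    have hpar := hc.parity
    rw [hloc, hx, Nat.even_iff, Nat.odd_iff]
    rcases Nat.mod_two_eq_zero_or_one M with h0 | h0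
    · exact Or.inl ⟨by omega, by rw [if_pos h0]⟩
    · exact Or.inr ⟨by omega, by rw [if_neg (by omega)]⟩
  · intro hnil
    rw [outTrace, List.flatMap_eq_nil_iff] at hnil
    exact outFactor_ne_nil (β := β₀) (k := k) (by rw [Fin.le_def]; exact hil)
      (by rw [Fin.le_def]; exact hlj) hko (hnil _ hβτ)

end Run

end TwoWay

theorem theorem7p3 {Q A Γ : Type*} [Fintype Q] (T : TwoWay.Transducer Q A Γ)
    (hT : T.Functional) (w : List A) (hw : T.IsInput w) (ρ : TwoWay.Run T w)
    (hρ : ρ.Successful) (hρn : ρ.Normalized)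
    (x₁ x₂ : ℕ) (hI : ρ.IsPosInterval x₁ x₂)
    (ℓ₁ ℓ₂ : ℕ × ℕ) (hK : ρ.LocLE ℓ₁ ℓ₂)
    (Z : Set (ℕ × ℕ)) (hZ : Z = ρ.locInterval ℓ₁ ℓ₂ ∩ {ℓ | x₁ ≤ ℓ.1 ∧ ℓ.1 ≤ x₂})
    (hout : T.bound < (ρ.outRestrict Z).length) :
    ∃ a b : ℕ, ρ.IsIdempotentLoop a b ∧
      ∃ (C : Set ℕ) (ℓ : ℕ × ℕ), ρ.IsComponent a b C ∧ ρ.IsAnchor a b C ℓ ∧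
        (x₁ < a ∧ a < b ∧ b < x₂) ∧
        (ρ.LocLT ℓ₁ ℓ ∧ ρ.LocLT ℓ ℓ₂) ∧
        ∃ τ, ρ.IsTrace a b C τ ∧ ρ.outTrace τ ≠ [] := by
  obtain ⟨i₁, i₂, hi, rfl, rfl⟩ := hK
  set S : Set (Fin ρ.len) := {k | ρ.loc k.castSucc ∈ Z ∧ ρ.loc k.succ ∈ Z} with hS
  set Y := (ρ.productive S).image fun k => ρ.head k.castSucc with hY
  -- Head places of transitions in `Z` may be `x₁ - 1` or lie on the border of `I`. Discarding four
  -- values costs the summand `4` in the bound and makes all loops strictly inside `I`. For `x₁ = 0`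
  -- the truncated `x₁ - 1` is `x₁` itself.
  set X := Y \ {x₁ - 1, x₁, x₂ - 1, x₂} with hX
  have hYX : Y.card ≤ X.card + 4 := by
    have h1 := Finset.card_le_card_sdiff_add_card (s := Y) (t := {x₁ - 1, x₁, x₂ - 1, x₂})
    have h2 : ({x₁ - 1, x₁, x₂ - 1, x₂} : Finset ℕ).card ≤ 4 := Finset.card_le_four
    rw [← hX] at h1
    omega
  have hcard : 2 ^ (3 * T.emax) < X.card := by
    by_contra hle
    have h1 := TwoWay.Run.length_outOn_le (ρ := ρ) S
    have h2 := TwoWay.Run.card_productive_le hρ hρn S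
    rw [← hY] at h2
    have h3 : (ρ.outRestrict Z).length ≤ T.capacity * (T.hmax * (2 ^ (3 * T.emax) + 4)) :=
      h1.trans (Nat.mul_le_mul_left _ (h2.trans (Nat.mul_le_mul_left _ (by omega))))
    rw [← mul_assoc] at h3
    rw [TwoWay.Transducer.bound] at hout
    omega
  have hXprop : ∀ x ∈ X, ∃ k ∈ S, (ρ.trans k).out ≠ [] ∧ ρ.head k.castSucc = x := by
    intro x hx
    obtain ⟨k, hk, rfl⟩ := Finset.mem_image.1 (Finset.mem_sdiff.1 hx).1
    simp only [TwoWay.Run.productive, Finset.mem_filter, Finset.mem_univ, true_and] at hk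
    exact ⟨k, hk.1, hk.2, rfl⟩
  have hXint : ∀ x ∈ X, x₁ < x ∧ x < x₂ := by
    intro x hx
    obtain ⟨k, hk, -, rfl⟩ := hXprop x hx
    have hnot := (Finset.mem_sdiff.1 hx).2
    simp only [Finset.mem_insert, Finset.mem_singleton, not_or] at hnot
    have h1 : x₁ ≤ ρ.pos k.castSucc ∧ ρ.pos k.castSucc ≤ x₂ := by
      have := hk.1
      rw [hZ] at this
      exact this.2
    have h2 := (ρ.headPath hρ).ps_eq (i := k) k.2.le
    rw [show (ρ.headPath hρ).ps k = _ from TwoWay.Run.headPath_ps hρ k.castSucc,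
      show (ρ.headPath hρ).hd k = _ from TwoWay.Run.headPath_hd hρ k.castSucc] at h2
    have := hI.1
    omega
  obtain ⟨a, ha, b, hb, hab, hloop, C, i, hC, hanchor, ⟨k, hk, hik⟩, ⟨k', hk', hik'⟩, hτ⟩ :=
    TwoWay.Run.exists_loop_of_card hρ hρn S X hXprop hcard
  have hbd : ∀ k ∈ S, i₁ ≤ k.castSucc ∧ k.succ ≤ i₂ := by
    intro k hk
    have h1 := hk.1
    have h2 := hk.2
    rw [hZ] at h1 h2
    exact ⟨(TwoWay.Run.time_bounds_of_mem hρ rfl rfl h1.1).1,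
      (TwoWay.Run.time_bounds_of_mem hρ rfl rfl h2.1).2⟩
  -- The anchor point comes after a whole transition of `K` and before another one, hence differs
  -- from both ends of `K`.
  have hlt₁ : i₁ < i := (hbd k' hk').1.trans_lt ((Fin.castSucc_lt_succ).trans_le hik')
  have hlt₂ : i < i₂ := hik.trans_lt ((Fin.castSucc_lt_succ).trans_le (hbd k hk).2)
  refine ⟨a, b, hloop, C, ρ.loc i, hC, hanchor, ⟨(hXint a ha).1, hab, (hXint b hb).2⟩,
    ⟨⟨⟨i₁, i, hlt₁.le, rfl, rfl⟩, ?_⟩, ⟨⟨i, i₂, hlt₂.le, rfl, rfl⟩, ?_⟩⟩, hτ⟩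
  · exact fun h => hlt₁.ne (TwoWay.Run.loc_injective hρ h)
  · exact fun h => hlt₂.ne (TwoWay.Run.loc_injective hρ h)
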